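/- For a non-empty set $X \subseteq \mathbb{R}^d$ let $\dim(X)$ denote the dimension of the affine subspace spanned by $X$, and for $\vec{v} \in \mathbb{R}^d \setminus \{0\}$ let $\pi_{\vec{v}}$ denote the orthogonal projection of $\mathbb{R}^d$ onto the hyperplane orthogonal to $\vec{v}$. Let $r_1, r_2, d$ be natural numbers with $r_1 \geq d \geq 2$, and let $A, B$ be finite, non-empty subsets of $\mathbb{R}^d$ such that $|A| \geq |B|$ and $\dim(A+B) = d$, where $A+B = \{a+b : a \in A,\ b \in B\}$. Let $\vec{v} \in \mathbb{R}^d \setminus \{0\}$ satisfy $|\pi_{\vec{v}}(A)| = r_1$ and $|\pi_{\vec{v}}(B)| = r_2$. Then \[ |A+B| \geq |A| + \bigg(d+1 - \frac{1}{r_1 - d + 2} - \frac{1}{r_2 - c + 2}\bigg)|B| - (d-1)(r_1 + r_2), \] where $c = d$ if $r_2 \geq d$, and $c = \dim(B)$ if $r_2 < d$. -/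

import Mathlib

open scoped Pointwise

noncomputable section

/-- The dimension of a subset of `ℝ^d`: the dimension of the affine subspace that it spans. -/
def affDim {d : ℕ} (A : Set (EuclideanSpace ℝ (Fin d))) : ℕ :=
  Module.finrank ℝ (affineSpan ℝ A).direction

/-- The hyperplane orthogonal to the vector `v` (for `v ≠ 0`). -/
def orthHyperplane {d : ℕ} (v : EuclideanSpace ℝ (Fin d)) :
    Submodule ℝ (EuclideanSpace ℝ (Fin d)) :=
  (Submodule.span ℝ {v})ᗮ

/-- The natural (orthogonal) projection of `ℝ^d` onto the hyperplane orthogonal to `v`. -/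
def projAlong {d : ℕ} (v : EuclideanSpace ℝ (Fin d)) :
    EuclideanSpace ℝ (Fin d) → orthHyperplane v :=
  fun x => (orthHyperplane v).orthogonalProjectionOnto x

end

/-! Take a basis of the space with `v` as the member of index `o` and the others taken from `A` and
`B`, after translating so that both sets contain 0. Replacing the points on each line of a
coordinate direction by an initial segment of ℕ keeps `|A|` and `|B|` and does not enlarge `A + B`,
by the bound `|X + Y| ≥ |X| + |Y| - 1` on lines. Beginning with the direction `o`, and thinking of
each line in that direction as a point of ℕ^(d-1) with a height, one reaches down-sets in ℕ^d with
`r₁` and `r₂` base points that contain between them every unit vector other than `e_o`.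

If no `e_s` with `s ≠ o` lies in both sets, `A` and `B` use complementary coordinates, so the `r₁
r₂` sums of base points are distinct and `|A + B| ≥ r₂|A| + r₁|B| - r₁r₂`
(`IsConfig.disjoint_bound`), which is enough.

If some `e_s` is shared, shears `x_s ↦ x_s + M x_j` followed by compressions push mass onto the axis
`s`. A pair of least weight off that axis is stable under them, and this makes each set a long
simplex: up to height, `k` (respectively `l`) consecutive points on the axis `s` together with some
unit vectors (`apply_eq_single_of_stable`). For these `IsLongSimplex.card_add_ge` adds up heights of
`A + B` over the axis, over the rows `e_j + n e_s` and over the sums `e_i + e_j`. The axis is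
handled by the averaging inequality `sum_line_le`, whence the terms `1/k` and `1/l`. At most `d - 2`
units lie off the axis, so `k ≥ r₁ - d + 2`; the dimension of the span of `v` and `B` gives `l ≥ r₂
- c + 2` in the same way.

When `r₂ < d` and `v` is not in the span of `B`, that span is too large for this count, but then the
projection is injective on `B` and `|A + B| ≥ |A|` suffices. -/

open Function

set_option linter.unusedSectionVars false

/-! ### Compression along a coordinate. -/

section Compression

variable {ι R : Type*} [Fintype ι] [DecidableEq ι] [Semiring R] [LinearOrder R]

/-- The points of `A` on the line through `x` in the direction of the coordinate `i`. -/
def fiber (i : ι) (A : Finset (ι → R)) (x : ι → R) : Finset (ι → R) :=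
  A.filter (fun y => ∀ k, k ≠ i → y k = x k)

/-- The number of points of `A` strictly below `x` on the line through `x` in direction `i`. -/
def rank (i : ι) (A : Finset (ι → R)) (x : ι → R) : ℕ :=
  ((fiber i A x).filter (fun y => y i < x i)).card

/-- The compression of `A` in the direction of the coordinate `i`: the points on every line in
this direction are replaced by an initial segment of the natural numbers. -/
def compress (i : ι) (A : Finset (ι → R)) : Finset (ι → R) :=
  A.image (fun x => update x i (rank i A x : R))

theorem mem_fiber {i : ι} {A : Finset (ι → R)} {x y : ι → R} :
    y ∈ fiber i A x ↔ y ∈ A ∧ ∀ k, k ≠ i → y k = x k := by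
  simp [fiber]

theorem fiber_congr {i : ι} {A : Finset (ι → R)} {x y : ι → R} (h : ∀ k, k ≠ i → x k = y k) :
    fiber i A x = fiber i A y := by
  ext z
  simp only [mem_fiber, and_congr_right_iff]
  exact fun _ => forall₂_congr fun k hk => by rw [h k hk]

theorem fiber_update (i : ι) (A : Finset (ι → R)) (x : ι → R) (c : R) :
    fiber i A (update x i c) = fiber i A x :=
  fiber_congr fun k hk => by simp [hk]

theorem self_mem_fiber {i : ι} {A : Finset (ι → R)} {x : ι → R} (h : x ∈ A) :
    x ∈ fiber i A x := mem_fiber.2 ⟨h, fun _ _ => rfl⟩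

theorem eq_of_mem_fiber {i : ι} {A : Finset (ι → R)} {x y z : ι → R} (hy : y ∈ fiber i A x)
    (hz : z ∈ fiber i A x) (h : y i = z i) : y = z := by
  funext k
  by_cases hk : k = i
  · rw [hk, h]
  · rw [(mem_fiber.1 hy).2 k hk, (mem_fiber.1 hz).2 k hk]

theorem rank_lt_card_fiber {i : ι} {A : Finset (ι → R)} {x : ι → R} (h : x ∈ A) :
    rank i A x < (fiber i A x).card := by
  apply Finset.card_lt_card
  rw [Finset.ssubset_iff_of_subset (Finset.filter_subset _ _)]
  exact ⟨x, self_mem_fiber h, by simp⟩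

theorem rank_lt_rank {i : ι} {A : Finset (ι → R)} {x y : ι → R} (hx : x ∈ A)
    (hxy : ∀ k, k ≠ i → x k = y k) (h : x i < y i) : rank i A x < rank i A y := by
  unfold rank
  rw [fiber_congr hxy]
  apply Finset.card_lt_card
  rw [Finset.ssubset_iff_of_subset]
  · exact ⟨x, by simp [mem_fiber, hx, h]; exact hxy, by simp⟩
  · intro z
    simp only [Finset.mem_filter]
    exact fun hz => ⟨hz.1, hz.2.trans h⟩

theorem eq_of_rank_eq {i : ι} {A : Finset (ι → R)} {x y : ι → R} (hx : x ∈ A) (hy : y ∈ A)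
    (hxy : ∀ k, k ≠ i → x k = y k) (h : rank i A x = rank i A y) : x = y := by
  funext k
  by_cases hk : k = i
  · subst hk
    rcases lt_trichotomy (x k) (y k) with h1 | h1 | h1
    · exact absurd h (rank_lt_rank hx hxy h1).ne
    · exact h1
    · exact absurd h.symm (rank_lt_rank hy (fun k hk => (hxy k hk).symm) h1).ne
  · exact hxy k hk

theorem exists_rank_eq {i : ι} {A : Finset (ι → R)} {x : ι → R} {n : ℕ}
    (hn : n < (fiber i A x).card) : ∃ y ∈ fiber i A x, rank i A y = n := by
  have hr : ∀ y ∈ fiber i A x, fiber i A y = fiber i A x := fun y hy =>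
    fiber_congr (mem_fiber.1 hy).2
  have himg : (fiber i A x).image (rank i A) = Finset.range (fiber i A x).card := by
    apply Finset.eq_of_subset_of_card_le
    · intro m hm
      obtain ⟨y, hy, rfl⟩ := Finset.mem_image.1 hm
      rw [Finset.mem_range, ← hr y hy]
      exact rank_lt_card_fiber (mem_fiber.1 hy).1
    · rw [Finset.card_range, Finset.card_image_of_injOn]
      intro y hy z hz h
      rw [Finset.mem_coe] at hy hz
      exact eq_of_rank_eq (mem_fiber.1 hy).1 (mem_fiber.1 hz).1
        (fun k hk => by rw [(mem_fiber.1 hy).2 k hk, (mem_fiber.1 hz).2 k hk]) h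
  have : n ∈ (fiber i A x).image (rank i A) := by rw [himg]; simpa using hn
  simpa using this

theorem mem_compress {i : ι} {A : Finset (ι → R)} {x : ι → R} :
    x ∈ compress i A ↔ ∃ n : ℕ, x i = n ∧ n < (fiber i A x).card := by
  constructor
  · intro h
    obtain ⟨y, hy, rfl⟩ := Finset.mem_image.1 h
    exact ⟨rank i A y, by simp, by rw [fiber_update]; exact rank_lt_card_fiber hy⟩
  · rintro ⟨n, hn, hlt⟩
    obtain ⟨y, hy, hr⟩ := exists_rank_eq hlt
    refine Finset.mem_image.2 ⟨y, (mem_fiber.1 hy).1, ?_⟩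
    funext k
    by_cases hk : k = i
    · subst hk; simp [hr, hn]
    · simp [hk, (mem_fiber.1 hy).2 k hk]

variable [IsStrictOrderedRing R]

theorem injOn_update_rank (i : ι) (A : Finset (ι → R)) :
    Set.InjOn (fun x => update x i (rank i A x : R)) A := by
  intro x hx y hy h
  simp only at h
  refine eq_of_rank_eq (i := i) hx hy (fun k hk => ?_) ?_
  · have := congrFun h k
    simpa [hk] using this
  · have := congrFun h i
    simpa using this

theorem card_compress (i : ι) (A : Finset (ι → R)) : (compress i A).card = A.card :=
  Finset.card_image_of_injOn (injOn_update_rank i A)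

/-- The Cauchy–Davenport bound in a linearly ordered group-like setting, applied to the
`i`-coordinates of two parallel lines. It is the only source of sumset growth in the whole argument.
-/
theorem card_fiber_add {i : ι} {A B : Finset (ι → R)} {x y : ι → R}
    (hx : (fiber i A x).Nonempty) (hy : (fiber i B y).Nonempty) :
    (fiber i A x).card + (fiber i B y).card ≤ (fiber i (A + B) (x + y)).card + 1 := by
  classical
  have hinj : ∀ (C : Finset (ι → R)) (z : ι → R),
      ((fiber i C z).image (fun u => u i)).card = (fiber i C z).card := fun C z =>
    Finset.card_image_of_injOn fun u hu w hw h => eq_of_mem_fiber hu hw h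
  have hsub : (fiber i A x).image (fun u => u i) + (fiber i B y).image (fun u => u i) ⊆
      (fiber i (A + B) (x + y)).image (fun u => u i) := by
    intro c hc
    obtain ⟨a, ha, b, hb, rfl⟩ := Finset.mem_add.1 hc
    obtain ⟨u, hu, rfl⟩ := Finset.mem_image.1 ha
    obtain ⟨w, hw, rfl⟩ := Finset.mem_image.1 hb
    refine Finset.mem_image.2 ⟨u + w, mem_fiber.2 ⟨Finset.add_mem_add (mem_fiber.1 hu).1
      (mem_fiber.1 hw).1, fun k hk => ?_⟩, rfl⟩
    simp [(mem_fiber.1 hu).2 k hk, (mem_fiber.1 hw).2 k hk]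
  have h1 := Finset.card_le_card hsub
  have h2 := cauchy_davenport_add_of_linearOrder_isCancelAdd (hx.image (fun u => u i))
    (hy.image (fun u => u i))
  simp only [hinj] at h1 h2
  omega

theorem compress_add_subset (i : ι) (A B : Finset (ι → R)) :
    compress i A + compress i B ⊆ compress i (A + B) := by
  intro z hz
  obtain ⟨x, hx, y, hy, rfl⟩ := Finset.mem_add.1 hz
  obtain ⟨n, hn, hn'⟩ := mem_compress.1 hx
  obtain ⟨m, hm, hm'⟩ := mem_compress.1 hy
  refine mem_compress.2 ⟨n + m, by simp [hn, hm], ?_⟩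
  have := card_fiber_add (Finset.card_pos.1 (by omega : 0 < (fiber i A x).card))
    (Finset.card_pos.1 (by omega : 0 < (fiber i B y).card))
  omega

theorem card_compress_add_le (i : ι) (A B : Finset (ι → R)) :
    (compress i A + compress i B).card ≤ (A + B).card := by
  rw [← card_compress i (A + B)]
  exact Finset.card_le_card (compress_add_subset i A B)

/-- `A` is closed under replacing the coordinate `o` by a smaller natural number. -/
def ClosedAlong (o : ι) (A : Finset (ι → R)) : Prop :=
  ∀ x ∈ A, ∀ n : ℕ, (n : R) ≤ x o → update x o (n : R) ∈ A

theorem closedAlong_compress (i : ι) (A : Finset (ι → R)) : ClosedAlong i (compress i A) := by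
  intro x hx n hn
  obtain ⟨m, hm, hm'⟩ := mem_compress.1 hx
  rw [hm, Nat.cast_le] at hn
  exact mem_compress.2 ⟨n, by simp, by rw [fiber_update]; omega⟩

/-- Lowering the coordinate `o` injects the `i`-line through a point into the `i`-line through the
lowered point, so the latter has at least as many points. -/
theorem ClosedAlong.closedAlong_compress {o i : ι} (hi : i ≠ o) {A : Finset (ι → R)} (h : ClosedAlong o A) :
    ClosedAlong o (compress i A) := by
  intro x hx n hn
  obtain ⟨m, hm, hm'⟩ := mem_compress.1 hx
  refine mem_compress.2 ⟨m, by simp [hi, hm], hm'.trans_le ?_⟩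
  refine Finset.card_le_card_of_injOn (fun y => update y o (n : R)) (fun y hy => ?_) ?_
  · rw [Finset.mem_coe] at hy
    have hy' := mem_fiber.1 hy
    refine mem_fiber.2 ⟨h y hy'.1 n ?_, fun k hk => ?_⟩
    · rw [hy'.2 o hi.symm]; exact hn
    · by_cases hk' : k = o
      · subst hk'; simp
      · simp [hk', hy'.2 k hk]
  · intro y hy z hz hyz
    refine eq_of_mem_fiber hy hz ?_
    have := congrFun hyz i
    simpa [hi] using this

/-- The points of `A` whose coordinate `o` vanishes. -/
def base (o : ι) (A : Finset (ι → R)) : Finset (ι → R) := A.filter (fun x => x o = 0)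

theorem mem_base {o : ι} {A : Finset (ι → R)} {x : ι → R} : x ∈ base o A ↔ x ∈ A ∧ x o = 0 := by
  simp [base]

theorem card_base_compress {o i : ι} (hi : i ≠ o) (A : Finset (ι → R)) :
    (base o (compress i A)).card = (base o A).card := by
  have : base o (compress i A) =
      (base o A).image (fun x => update x i (rank i A x : R)) := by
    ext x
    simp only [base, compress, Finset.mem_filter, Finset.mem_image]
    constructor
    · rintro ⟨⟨y, hy, rfl⟩, h⟩
      exact ⟨y, ⟨hy, by simpa [hi.symm] using h⟩, rfl⟩
    · rintro ⟨y, ⟨hy, h⟩, rfl⟩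
      exact ⟨⟨y, hy, rfl⟩, by simpa [hi.symm] using h⟩
  rw [this]
  exact Finset.card_image_of_injOn ((injOn_update_rank i A).mono (by
    intro x hx; exact (mem_base.1 hx).1))

theorem mem_compress_of_eq_zero {i : ι} {A : Finset (ι → R)} {x y : ι → R} (hy : y ∈ A)
    (hxy : ∀ k, k ≠ i → y k = x k) (hx : x i = 0) : x ∈ compress i A :=
  mem_compress.2 ⟨0, by simp [hx], Finset.card_pos.2 ⟨y, mem_fiber.2 ⟨hy, hxy⟩⟩⟩

theorem mem_compress_of_eq_one {i : ι} {A : Finset (ι → R)} {x y z : ι → R} (hy : y ∈ A)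
    (hxy : ∀ k, k ≠ i → y k = x k) (hz : z ∈ A) (hxz : ∀ k, k ≠ i → z k = x k) (hyz : y ≠ z)
    (hx : x i = 1) : x ∈ compress i A :=
  mem_compress.2 ⟨1, by simp [hx], Finset.one_lt_card.2
    ⟨y, mem_fiber.2 ⟨hy, hxy⟩, z, mem_fiber.2 ⟨hz, hxz⟩, hyz⟩⟩

theorem single_mem_compress {i j : ι} {A : Finset (ι → R)} (h0 : 0 ∈ A)
    (hj : Pi.single j 1 ∈ A) : Pi.single j 1 ∈ compress i A := by
  by_cases h : j = i
  · subst h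
    refine mem_compress_of_eq_one h0 (fun k hk => by simp [hk]) hj (fun _ _ => rfl) ?_ (by simp)
    intro h
    have := congrFun h j
    simp at this
  · exact mem_compress_of_eq_zero hj (fun _ _ => rfl) (by simp [Ne.symm h])

theorem compress_apply_eq_zero {i j : ι} {A : Finset (ι → R)} (h : ∀ x ∈ A, x j = 0) :
    ∀ x ∈ compress i A, x j = 0 := by
  intro x hx
  obtain ⟨y, hy, rfl⟩ := Finset.mem_image.1 hx
  by_cases hij : j = i
  · subst hij
    have : rank j A y = 0 := by
      unfold rank
      rw [Finset.card_eq_zero, Finset.filter_eq_empty_iff]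
      intro z hz
      rw [h y hy, h z (mem_fiber.1 hz).1]
      simp
    simp [this]
  · simp [hij, h y hy]

end Compression

/-! ### Configurations and the passage from an ordered semiring to ℕ. -/

section Config

variable {ι R : Type*} [Fintype ι] [DecidableEq ι] [Semiring R] [LinearOrder R]

/-- Pairs of sets with prescribed cardinalities, prescribed numbers of lines in direction `o`, and
a bounded sumset, that are closed along `o`, contain the origin, contain between them
the unit vectors, and are supported on prescribed coordinates. -/
structure IsConfig (o : ι) (SA SB : Finset ι) (nA nB r₁ r₂ N : ℕ) (A B : Finset (ι → R)) :
    Prop where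
  card_left : A.card = nA
  card_right : B.card = nB
  card_add : (A + B).card ≤ N
  base_left : (base o A).card = r₁
  base_right : (base o B).card = r₂
  closed_left : ClosedAlong o A
  closed_right : ClosedAlong o B
  zero_left : 0 ∈ A
  zero_right : 0 ∈ B
  single_mem : ∀ j, j ≠ o → Pi.single j 1 ∈ A ∨ Pi.single j 1 ∈ B
  supp_left : ∀ j, j ∉ SA → j ≠ o → ∀ x ∈ A, x j = 0
  supp_right : ∀ j, j ∉ SB → j ≠ o → ∀ x ∈ B, x j = 0

variable {o : ι} {SA SB : Finset ι} {nA nB r₁ r₂ N : ℕ} {A B : Finset (ι → R)}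

theorem IsConfig.symm (h : IsConfig o SA SB nA nB r₁ r₂ N A B) :
    IsConfig o SB SA nB nA r₂ r₁ N B A where
  card_left := h.card_right
  card_right := h.card_left
  card_add := by rw [add_comm]; exact h.card_add
  base_left := h.base_right
  base_right := h.base_left
  closed_left := h.closed_right
  closed_right := h.closed_left
  zero_left := h.zero_right
  zero_right := h.zero_left
  single_mem j hj := (h.single_mem j hj).symm
  supp_left := h.supp_right
  supp_right := h.supp_left

/-- The direction `o` is excluded because only the other compressions act inside the hyperplane `x o
= 0` and so keep the number of base points. -/
theorem IsConfig.isConfig_compress [IsStrictOrderedRing R] (h : IsConfig o SA SB nA nB r₁ r₂ N A B)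
    {i : ι} (hi : i ≠ o) :
    IsConfig o SA SB nA nB r₁ r₂ N (compress i A) (compress i B) where
  card_left := by rw [card_compress, h.card_left]
  card_right := by rw [card_compress, h.card_right]
  card_add := (card_compress_add_le i A B).trans h.card_add
  base_left := by rw [card_base_compress hi, h.base_left]
  base_right := by rw [card_base_compress hi, h.base_right]
  closed_left := h.closed_left.closedAlong_compress hi
  closed_right := h.closed_right.closedAlong_compress hi
  zero_left := mem_compress_of_eq_zero h.zero_left (fun _ _ => rfl) rfl
  zero_right := mem_compress_of_eq_zero h.zero_right (fun _ _ => rfl) rfl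
  single_mem j hj := (h.single_mem j hj).imp (single_mem_compress h.zero_left)
    (single_mem_compress h.zero_right)
  supp_left j hj hj' := compress_apply_eq_zero (h.supp_left j hj hj')
  supp_right j hj hj' := compress_apply_eq_zero (h.supp_right j hj hj')

theorem compress_apply_eq_cast {i j : ι} (h : j = i ∨ ∀ x ∈ A, ∃ n : ℕ, x j = n) :
    ∀ x ∈ compress i A, ∃ n : ℕ, x j = n := by
  intro x hx
  obtain ⟨y, hy, rfl⟩ := Finset.mem_image.1 hx
  by_cases hji : j = i
  · exact ⟨rank i A y, by simp [hji]⟩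
  · obtain ⟨n, hn⟩ := (h.resolve_left hji) y hy
    exact ⟨n, by simp [hji, hn]⟩

theorem IsConfig.exists_apply_eq_cast [IsStrictOrderedRing R]
    (h : IsConfig o SA SB nA nB r₁ r₂ N A B)
    (hA : ∀ x ∈ A, ∃ n : ℕ, x o = n) (hB : ∀ x ∈ B, ∃ n : ℕ, x o = n) :
    ∃ A' B' : Finset (ι → R), IsConfig o SA SB nA nB r₁ r₂ N A' B' ∧
      (∀ j, ∀ x ∈ A', ∃ n : ℕ, x j = n) ∧ (∀ j, ∀ x ∈ B', ∃ n : ℕ, x j = n) := by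
  suffices H : ∀ t : Finset ι, o ∉ t →
      ∃ A' B' : Finset (ι → R), IsConfig o SA SB nA nB r₁ r₂ N A' B' ∧
      (∀ j ∈ insert o t, ∀ x ∈ A', ∃ n : ℕ, x j = n) ∧
      (∀ j ∈ insert o t, ∀ x ∈ B', ∃ n : ℕ, x j = n) by
    obtain ⟨A', B', h', hA', hB'⟩ := H (Finset.univ.erase o) (by simp)
    exact ⟨A', B', h', fun j => hA' j (by by_cases hj : j = o <;> simp [hj]),
      fun j => hB' j (by by_cases hj : j = o <;> simp [hj])⟩
  intro t
  induction t using Finset.induction_on with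
  | empty => exact fun _ => ⟨A, B, h, by simpa using hA, by simpa using hB⟩
  | insert i t hi ih =>
    intro ho
    rw [Finset.mem_insert, not_or] at ho
    obtain ⟨A', B', h', hA', hB'⟩ := ih ho.2
    refine ⟨compress i A', compress i B', h'.isConfig_compress (Ne.symm ho.1),
      fun j hj => compress_apply_eq_cast ?_, fun j hj => compress_apply_eq_cast ?_⟩
    · rcases eq_or_ne j i with hji | hji
      · exact Or.inl hji
      · exact Or.inr (hA' j (by simp only [Finset.mem_insert] at hj ⊢; tauto))
    · rcases eq_or_ne j i with hji | hji
      · exact Or.inl hji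
      · exact Or.inr (hB' j (by simp only [Finset.mem_insert] at hj ⊢; tauto))

theorem exists_nat_image [IsStrictOrderedRing R] (hA : ∀ j, ∀ x ∈ A, ∃ n : ℕ, x j = n) :
    ∃ A' : Finset (ι → ℕ), A = A'.image (fun x j => (x j : R)) := by
  classical
  choose! f hf using hA
  refine ⟨A.image (fun x j => f j x), ?_⟩
  rw [Finset.image_image]
  ext x
  simp only [Finset.mem_image, comp_apply]
  constructor
  · exact fun hx => ⟨x, hx, funext fun j => (hf j x hx).symm⟩
  · rintro ⟨y, hy, rfl⟩
    convert hy using 1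
    exact funext fun j => (hf j y hy).symm

/-- Natural coordinates are needed for the minimality arguments below, which use a weight with
values in ℕ. The coordinatewise cast is injective and additive, so every field is pulled back along
it. -/
theorem IsConfig.exists_nat [IsStrictOrderedRing R]
    (h : IsConfig o SA SB nA nB r₁ r₂ N A B)
    (hA : ∀ x ∈ A, ∃ n : ℕ, x o = n) (hB : ∀ x ∈ B, ∃ n : ℕ, x o = n) :
    ∃ A' B' : Finset (ι → ℕ), IsConfig o SA SB nA nB r₁ r₂ N A' B' := by
  obtain ⟨A', B', h', hA', hB'⟩ := h.exists_apply_eq_cast hA hB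
  obtain ⟨X, rfl⟩ := exists_nat_image hA'
  obtain ⟨Y, rfl⟩ := exists_nat_image hB'
  set c : (ι → ℕ) → (ι → R) := fun x j => (x j : R) with hc
  have hinj : Injective c := fun x y hxy => funext fun j => by
    have := congrFun hxy j
    simpa [hc] using this
  have hmem : ∀ (Z : Finset (ι → ℕ)) (z : ι → ℕ), c z ∈ Z.image c → z ∈ Z := fun Z z hz => by
    obtain ⟨w, hw, hwz⟩ := Finset.mem_image.1 hz
    rwa [← hinj hwz]
  have hadd : X.image c + Y.image c = (X + Y).image c := by
    ext z
    simp only [Finset.mem_add, Finset.mem_image]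
    constructor
    · rintro ⟨_, ⟨x, hx, rfl⟩, _, ⟨y, hy, rfl⟩, rfl⟩
      exact ⟨x + y, ⟨x, hx, y, hy, rfl⟩, by simp [hc, funext_iff]⟩
    · rintro ⟨_, ⟨x, hx, y, hy, rfl⟩, rfl⟩
      exact ⟨c x, ⟨x, hx, rfl⟩, c y, ⟨y, hy, rfl⟩, by simp [hc, funext_iff]⟩
  have hbase : ∀ Z : Finset (ι → ℕ), (base o (Z.image c)).card = (base o Z).card := fun Z => by
    rw [← Finset.card_image_of_injective _ hinj]
    congr 1
    ext z
    simp only [mem_base, Finset.mem_image]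
    constructor
    · rintro ⟨⟨x, hx, rfl⟩, hz⟩
      exact ⟨x, ⟨hx, by simpa [hc] using hz⟩, rfl⟩
    · rintro ⟨x, ⟨hx, hz⟩, rfl⟩
      exact ⟨⟨x, hx, rfl⟩, by simpa [hc] using hz⟩
  have hclosed : ∀ Z : Finset (ι → ℕ), ClosedAlong o (Z.image c) → ClosedAlong o Z :=
    fun Z hZ x hx n hn => by
      refine hmem _ _ ?_
      have := hZ (c x) (Finset.mem_image_of_mem _ hx) n (by simpa [hc] using hn)
      convert this using 1
      funext k
      by_cases hk : k = o
      · subst hk; simp [hc]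
      · simp [hc, hk]
  have hzero : ∀ Z : Finset (ι → ℕ), 0 ∈ Z.image c → 0 ∈ Z := fun Z hZ => by
    refine hmem _ _ ?_
    convert hZ using 1
    simp [hc, funext_iff]
  have hsingle : ∀ (Z : Finset (ι → ℕ)) (j : ι), Pi.single j 1 ∈ Z.image c → Pi.single j 1 ∈ Z :=
    fun Z j hZ => by
      refine hmem _ _ ?_
      convert hZ using 1
      funext k
      by_cases hk : k = j
      · subst hk; simp [hc]
      · simp [hc, hk]
  refine ⟨X, Y, ⟨?_, ?_, ?_, ?_, ?_, ?_, ?_, ?_, ?_, ?_, ?_, ?_⟩⟩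
  · rw [← h'.card_left, Finset.card_image_of_injective _ hinj]
  · rw [← h'.card_right, Finset.card_image_of_injective _ hinj]
  · rw [← Finset.card_image_of_injective _ hinj, ← hadd]; exact h'.card_add
  · rw [← hbase, h'.base_left]
  · rw [← hbase, h'.base_right]
  · exact hclosed _ h'.closed_left
  · exact hclosed _ h'.closed_right
  · exact hzero _ h'.zero_left
  · exact hzero _ h'.zero_right
  · exact fun j hj => (h'.single_mem j hj).imp (hsingle _ _) (hsingle _ _)
  · intro j hj hj' x hx
    simpa [hc] using h'.supp_left j hj hj' (c x) (Finset.mem_image_of_mem _ hx)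
  · intro j hj hj' x hx
    simpa [hc] using h'.supp_right j hj hj' (c x) (Finset.mem_image_of_mem _ hx)

end Config

/-! ### Shears, minimal configurations and their shape. -/

section Minimal

variable {ι : Type*} [Fintype ι] [DecidableEq ι]

/-- The sum of all coordinates other than `o` and `s` over all points of `A`. -/
def offWeight (o s : ι) (A : Finset (ι → ℕ)) : ℕ :=
  ∑ x ∈ A, ∑ k ∈ Finset.univ.filter (fun k => k ≠ o ∧ k ≠ s), x k

/-- The shear that adds `N` times the coordinate `j` to the coordinate `s`. -/
def shear (s j : ι) (N : ℕ) (x : ι → ℕ) : ι → ℕ := update x s (x s + N * x j)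

theorem rank_le_apply (i : ι) (A : Finset (ι → ℕ)) (x : ι → ℕ) : rank i A x ≤ x i := by
  unfold rank
  rw [← Finset.card_range (x i)]
  refine Finset.card_le_card_of_injOn (fun y => y i) (fun y hy => ?_) ?_
  · simpa using (Finset.mem_filter.1 hy).2
  · intro y hy z hz h
    exact eq_of_mem_fiber (Finset.mem_filter.1 hy).1 (Finset.mem_filter.1 hz).1 h

theorem offWeight_compress (o s i : ι) (A : Finset (ι → ℕ)) :
    offWeight o s (compress i A) = ∑ x ∈ A,
      ∑ k ∈ Finset.univ.filter (fun k => k ≠ o ∧ k ≠ s), update x i (rank i A x) k := by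
  unfold offWeight compress
  exact Finset.sum_image (injOn_update_rank i A)

theorem offWeight_compress_le (o s i : ι) (A : Finset (ι → ℕ)) :
    offWeight o s (compress i A) ≤ offWeight o s A := by
  rw [offWeight_compress]
  refine Finset.sum_le_sum fun x _ => Finset.sum_le_sum fun k _ => ?_
  by_cases hk : k = i
  · subst hk; simpa using rank_le_apply k A x
  · simp [hk]

/-- Compression moves each point `x` down to `rank i A x ≤ x i`. If the weight does not drop,
nothing moves, so `A` is its own compression. -/
theorem closedAlong_of_offWeight_le {o s i : ι} (hio : i ≠ o) (his : i ≠ s)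
    {A : Finset (ι → ℕ)} (h : offWeight o s A ≤ offWeight o s (compress i A)) :
    ClosedAlong i A := by
  have hle : ∀ x : ι → ℕ, ∀ k, update x i (rank i A x) k ≤ x k := fun x k => by
    by_cases hk : k = i
    · subst hk; simpa using rank_le_apply k A x
    · simp [hk]
  have hrank : ∀ x ∈ A, rank i A x = x i := by
    intro x hx
    by_contra hne
    refine absurd h (not_le.2 ?_)
    rw [offWeight_compress]
    refine Finset.sum_lt_sum (fun y _ => Finset.sum_le_sum fun k _ => hle y k) ⟨x, hx, ?_⟩
    refine Finset.sum_lt_sum (fun k _ => hle x k) ⟨i, by simp [hio, his], ?_⟩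
    simpa using lt_of_le_of_ne (rank_le_apply i A x) hne
  have : compress i A = A := by
    unfold compress
    conv_rhs => rw [← Finset.image_id (s := A)]
    refine Finset.image_congr fun x hx => ?_
    have := hrank x hx
    simp [this]
  rw [← this]
  exact closedAlong_compress i A

theorem shear_injective {s j : ι} (hj : j ≠ s) (N : ℕ) : Injective (shear s j N) := by
  intro x y h
  have hk : ∀ k, k ≠ s → x k = y k := fun k hk => by
    simpa [shear, hk] using congrFun h k
  funext k
  by_cases hks : k = s
  · subst hks
    have := congrFun h k
    simp only [shear, update_self, hk j hj] at this
    omega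
  · exact hk k hks

theorem shear_add {s j : ι} (hj : j ≠ s) (N : ℕ) (x y : ι → ℕ) :
    shear s j N (x + y) = shear s j N x + shear s j N y := by
  funext k
  by_cases hk : k = s
  · subst hk; simp [shear]; ring
  · simp [shear, hk]

theorem image_shear_add {s j : ι} (hj : j ≠ s) (N : ℕ) (A B : Finset (ι → ℕ)) :
    A.image (shear s j N) + B.image (shear s j N) = (A + B).image (shear s j N) := by
  ext z
  simp only [Finset.mem_add, Finset.mem_image]
  constructor
  · rintro ⟨_, ⟨x, hx, rfl⟩, _, ⟨y, hy, rfl⟩, rfl⟩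
    exact ⟨x + y, ⟨x, hx, y, hy, rfl⟩, shear_add hj N x y⟩
  · rintro ⟨_, ⟨x, hx, y, hy, rfl⟩, rfl⟩
    exact ⟨_, ⟨x, hx, rfl⟩, _, ⟨y, hy, rfl⟩, (shear_add hj N x y).symm⟩

theorem offWeight_image_shear {s j : ι} (o : ι) (hj : j ≠ s) (N : ℕ) (A : Finset (ι → ℕ)) :
    offWeight o s (A.image (shear s j N)) = offWeight o s A := by
  unfold offWeight
  rw [Finset.sum_image (shear_injective hj N).injOn]
  refine Finset.sum_congr rfl fun x _ => Finset.sum_congr rfl fun k hk => ?_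
  simp [shear, (Finset.mem_filter.1 hk).2.2]

theorem card_base_image_shear {o s j : ι} (hj : j ≠ s) (hs : s ≠ o) (N : ℕ)
    (A : Finset (ι → ℕ)) : (base o (A.image (shear s j N))).card = (base o A).card := by
  rw [← Finset.card_image_of_injective (base o A) (shear_injective hj N)]
  congr 1
  ext z
  simp only [mem_base, Finset.mem_image]
  constructor
  · rintro ⟨⟨x, hx, rfl⟩, hz⟩
    exact ⟨x, ⟨hx, by simpa [shear, hs.symm] using hz⟩, rfl⟩
  · rintro ⟨x, ⟨hx, hz⟩, rfl⟩
    exact ⟨⟨x, hx, rfl⟩, by simpa [shear, hs.symm] using hz⟩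

theorem ClosedAlong.closedAlong_image_shear {o s j : ι} (hs : s ≠ o) (hjo : j ≠ o) {N : ℕ}
    {A : Finset (ι → ℕ)} (h : ClosedAlong o A) : ClosedAlong o (A.image (shear s j N)) := by
  intro x hx n hn
  obtain ⟨y, hy, rfl⟩ := Finset.mem_image.1 hx
  refine Finset.mem_image.2 ⟨update y o n, h y hy n (by simpa [shear, hs.symm] using hn), ?_⟩
  simp only [shear, Nat.cast_id]
  rw [update_comm hs]
  simp [hs, hjo]

/-- Shearing along `s` and then compressing in the directions `j` and `s`. -/
def shearCompress (s j : ι) (N : ℕ) (A : Finset (ι → ℕ)) : Finset (ι → ℕ) :=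
  compress s (compress j (A.image (shear s j N)))

theorem single_mem_shearCompress {s j i : ι} {N : ℕ} (hij : i ≠ j)
    {A : Finset (ι → ℕ)} (h0 : 0 ∈ A) (h : Pi.single i 1 ∈ A) :
    Pi.single i 1 ∈ shearCompress s j N A := by
  have h0' : 0 ∈ A.image (shear s j N) :=
    Finset.mem_image.2 ⟨0, h0, by simp [shear]⟩
  refine single_mem_compress (mem_compress_of_eq_zero h0' (fun _ _ => rfl) rfl)
    (single_mem_compress h0' (Finset.mem_image.2 ⟨_, h, ?_⟩))
  simp [shear, hij.symm]

/-- The shear sends `e_j` to `e_j + N e_s` and fixes `N e_s`. These are two points on one `j`-line,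
so the compression along `j` retains `e_j + N e_s`, and the compression along `s` brings it down to
`e_j`. Without `N e_s` the unit vector could be lost. -/
theorem single_mem_shearCompress_self {s j : ι} (hj : j ≠ s) {N : ℕ}
    {A : Finset (ι → ℕ)} (h : Pi.single j 1 ∈ A) (hN : Pi.single s N ∈ A) :
    Pi.single j 1 ∈ shearCompress s j N A := by
  have h1 : shear s j N (Pi.single j 1) ∈ A.image (shear s j N) := Finset.mem_image_of_mem _ h
  have h2 : shear s j N (Pi.single s N) ∈ A.image (shear s j N) := Finset.mem_image_of_mem _ hN
  have h3 : shear s j N (Pi.single j 1) ∈ compress j (A.image (shear s j N)) := by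
    refine mem_compress_of_eq_one h1 (fun _ _ => rfl) h2 (fun k hk => ?_) ?_ (by simp [shear, hj])
    · by_cases hks : k = s
      · subst hks; simp [shear, hj, hj.symm]
      · simp [shear, hks, hk]
    · intro he
      have := congrFun (shear_injective hj N he) j
      simp [hj] at this
  exact mem_compress_of_eq_zero h3 (fun k hk => by simp [shear, hk]) (by simp [hj.symm])

variable {o s : ι} {SA SB : Finset ι} {nA nB r₁ r₂ N : ℕ} {A B : Finset (ι → ℕ)}

theorem IsConfig.isConfig_shearCompress (h : IsConfig o SA SB nA nB r₁ r₂ N A B) (hs : s ≠ o)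
    (hsA : s ∈ SA) (hsB : s ∈ SB) {j : ι} (hj : j ≠ s) (hjo : j ≠ o) {M : ℕ}
    (hM : (Pi.single j 1 ∈ A ∧ Pi.single s M ∈ A) ∨ (Pi.single j 1 ∈ B ∧ Pi.single s M ∈ B)) :
    IsConfig o SA SB nA nB r₁ r₂ N (shearCompress s j M A) (shearCompress s j M B) where
  card_left := by
    rw [shearCompress, card_compress, card_compress,
      Finset.card_image_of_injective _ (shear_injective hj M), h.card_left]
  card_right := by
    rw [shearCompress, card_compress, card_compress,
      Finset.card_image_of_injective _ (shear_injective hj M), h.card_right]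
  card_add := by
    refine ((card_compress_add_le _ _ _).trans (card_compress_add_le _ _ _)).trans ?_
    rw [image_shear_add hj, Finset.card_image_of_injective _ (shear_injective hj M)]
    exact h.card_add
  base_left := by
    rw [shearCompress, card_base_compress hs, card_base_compress hjo,
      card_base_image_shear hj hs, h.base_left]
  base_right := by
    rw [shearCompress, card_base_compress hs, card_base_compress hjo,
      card_base_image_shear hj hs, h.base_right]
  closed_left := ((h.closed_left.closedAlong_image_shear hs hjo).closedAlong_compress hjo).closedAlong_compress hs
  closed_right := ((h.closed_right.closedAlong_image_shear hs hjo).closedAlong_compress hjo).closedAlong_compress hs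
  zero_left := mem_compress_of_eq_zero (mem_compress_of_eq_zero (Finset.mem_image.2
    ⟨0, h.zero_left, by simp [shear]⟩) (fun _ _ => rfl) rfl)
    (fun _ _ => rfl) rfl
  zero_right := mem_compress_of_eq_zero (mem_compress_of_eq_zero (Finset.mem_image.2
    ⟨0, h.zero_right, by simp [shear]⟩) (fun _ _ => rfl) rfl)
    (fun _ _ => rfl) rfl
  single_mem i hi := by
    by_cases hij : i = j
    · subst hij
      exact hM.imp (fun hh => single_mem_shearCompress_self hj hh.1 hh.2)
        (fun hh => single_mem_shearCompress_self hj hh.1 hh.2)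
    · exact (h.single_mem i hi).imp (single_mem_shearCompress hij h.zero_left)
        (single_mem_shearCompress hij h.zero_right)
  supp_left i hi hio := by
    refine compress_apply_eq_zero (compress_apply_eq_zero fun x hx => ?_)
    obtain ⟨y, hy, rfl⟩ := Finset.mem_image.1 hx
    have his : i ≠ s := fun he => hi (he ▸ hsA)
    simpa [shear, his] using h.supp_left i hi hio y hy
  supp_right i hi hio := by
    refine compress_apply_eq_zero (compress_apply_eq_zero fun x hx => ?_)
    obtain ⟨y, hy, rfl⟩ := Finset.mem_image.1 hx
    have his : i ≠ s := fun he => hi (he ▸ hsB)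
    simpa [shear, his] using h.supp_right i hi hio y hy

/-- Every configuration can be transformed into one that is stable under compressions, also after
shearing. -/
theorem IsConfig.exists_stable (h : IsConfig o SA SB nA nB r₁ r₂ N A B) (hs : s ≠ o)
    (hsA : Pi.single s 1 ∈ A) (hsB : Pi.single s 1 ∈ B) :
    ∃ A' B' : Finset (ι → ℕ), IsConfig o SA SB nA nB r₁ r₂ N A' B' ∧
      Pi.single s 1 ∈ A' ∧ Pi.single s 1 ∈ B' ∧
      (∀ j, ClosedAlong j A' ∧ ClosedAlong j B') ∧
      ∀ j, j ≠ o → j ≠ s → ∀ M,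
        (Pi.single j 1 ∈ A' ∧ Pi.single s M ∈ A') ∨ (Pi.single j 1 ∈ B' ∧ Pi.single s M ∈ B') →
        ClosedAlong j (A'.image (shear s j M)) ∧ ClosedAlong j (B'.image (shear s j M)) := by
  have hmemA : s ∈ SA := by
    by_contra hc
    simpa using h.supp_left s hc hs _ hsA
  have hmemB : s ∈ SB := by
    by_contra hc
    simpa using h.supp_right s hc hs _ hsB
  let P : Set (Finset (ι → ℕ) × Finset (ι → ℕ)) := {p |
    IsConfig o SA SB nA nB r₁ r₂ N p.1 p.2 ∧ Pi.single s 1 ∈ p.1 ∧ Pi.single s 1 ∈ p.2}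
  -- The weight ignores the coordinate `s`, the only one that a shear changes. Hence a shear costs
  -- nothing, and a compression along `j` that moves a point after it would contradict minimality.
  obtain ⟨⟨A₀, B₀⟩, ⟨h₀, h₀A, h₀B⟩, hmin⟩ := WellFounded.has_min
    (measure (fun p : Finset (ι → ℕ) × Finset (ι → ℕ) =>
      offWeight o s p.1 + offWeight o s p.2)).wf P ⟨(A, B), h, hsA, hsB⟩
  have hmin' : ∀ A₁ B₁ : Finset (ι → ℕ), IsConfig o SA SB nA nB r₁ r₂ N A₁ B₁ →
      Pi.single s 1 ∈ A₁ → Pi.single s 1 ∈ B₁ →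
      offWeight o s A₀ + offWeight o s B₀ ≤ offWeight o s A₁ + offWeight o s B₁ :=
    fun A₁ B₁ h1 h2 h3 => not_lt.1 (hmin (A₁, B₁) ⟨h1, h2, h3⟩)
  replace h₀ : IsConfig o SA SB nA nB r₁ r₂ N A₀ B₀ := h₀
  have h₁ := h₀.isConfig_compress hs
  have h₁A := single_mem_compress (i := s) h₀.zero_left h₀A
  have h₁B := single_mem_compress (i := s) h₀.zero_right h₀B
  have hwA := offWeight_compress_le o s s A₀
  have hwB := offWeight_compress_le o s s B₀
  -- Minimality says nothing about the direction `s`; a last compression along `s` does not raise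
  -- the weight, so the new pair is still minimal.
  refine ⟨compress s A₀, compress s B₀, h₁, h₁A, h₁B, fun j => ?_, fun j hjo hjs M hM => ?_⟩
  · by_cases hjo : j = o
    · subst hjo; exact ⟨h₁.closed_left, h₁.closed_right⟩
    by_cases hjs : j = s
    · subst hjs; exact ⟨closedAlong_compress _ _, closedAlong_compress _ _⟩
    have := hmin' _ _ (h₁.isConfig_compress hjo) (single_mem_compress h₁.zero_left h₁A)
      (single_mem_compress h₁.zero_right h₁B)
    have hA := offWeight_compress_le o s j (compress s A₀)
    have hB := offWeight_compress_le o s j (compress s B₀)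
    exact ⟨closedAlong_of_offWeight_le hjo hjs (by omega),
      closedAlong_of_offWeight_le hjo hjs (by omega)⟩
  · have := hmin' _ _ (h₁.isConfig_shearCompress hs hmemA hmemB hjs hjo hM)
      (single_mem_shearCompress hjs.symm h₁.zero_left h₁A)
      (single_mem_shearCompress hjs.symm h₁.zero_right h₁B)
    unfold shearCompress at this
    have hA := offWeight_compress_le o s j ((compress s A₀).image (shear s j M))
    have hB := offWeight_compress_le o s j ((compress s B₀).image (shear s j M))
    have hA' := offWeight_compress_le o s s (compress j ((compress s A₀).image (shear s j M)))
    have hB' := offWeight_compress_le o s s (compress j ((compress s B₀).image (shear s j M)))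
    have hA'' := offWeight_image_shear o hjs M (compress s A₀)
    have hB'' := offWeight_image_shear o hjs M (compress s B₀)
    exact ⟨closedAlong_of_offWeight_le hjo hjs (by omega),
      closedAlong_of_offWeight_le hjo hjs (by omega)⟩

theorem mem_of_le_of_closedAlong (h : ∀ j, ClosedAlong j A) {x y : ι → ℕ} (hx : x ∈ A)
    (hyx : y ≤ x) : y ∈ A := by
  have : ∀ t : Finset ι, t.piecewise y x ∈ A := by
    intro t
    induction t using Finset.induction_on with
    | empty => simpa using hx
    | insert j t hj ih =>
      rw [Finset.piecewise_insert]
      exact h j _ ih (y j) (by simpa [hj] using hyx j)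
  simpa using this Finset.univ

theorem exists_single_mem_iff (h : ∀ j, ClosedAlong j A) (s : ι) :
    ∃ k : ℕ, ∀ n, Pi.single s n ∈ A ↔ n < k := by
  have hex : ∃ n : ℕ, (Pi.single s n : ι → ℕ) ∉ A := by
    by_contra! hc
    exact (Set.infinite_of_injective_forall_mem (Pi.single_injective s) hc) A.finite_toSet
  refine ⟨Nat.find hex, fun n => ⟨fun hn => ?_, fun hn => not_not.1 (Nat.find_min hex hn)⟩⟩
  by_contra! hle
  exact Nat.find_spec hex (mem_of_le_of_closedAlong h hn (Pi.single_le_single.2 hle))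

/-- Lower the `j`-coordinate of the sheared point by one and undo the shear: with `x_s + M x_j`
fixed, the coordinate `s` must gain `M`. -/
theorem mem_of_closedAlong_image_shear {j : ι} (hj : j ≠ s) {M : ℕ}
    (h : ClosedAlong j (A.image (shear s j M))) {x : ι → ℕ} (hx : x ∈ A) (hxj : 1 ≤ x j) :
    update (update x j (x j - 1)) s (x s + M) ∈ A := by
  have := h _ (Finset.mem_image_of_mem _ hx) (x j - 1) (by simp [shear, hj])
  obtain ⟨y, hy, hyx⟩ := Finset.mem_image.1 this
  convert hy using 1
  refine shear_injective hj M (Eq.trans ?_ hyx.symm)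
  funext k
  by_cases hks : k = s
  · subst hks
    obtain ⟨n, hn⟩ := Nat.exists_eq_add_of_le hxj
    simp [shear, hj, hj.symm, hn]
    ring
  · by_cases hkj : k = j
    · subst hkj; simp [shear, hks]
    · simp [shear, hks, hkj]

/-- In a stable configuration, every point of the first set off the line of direction `s` is, up
to the coordinate `o`, a unit vector. -/
theorem apply_eq_single_of_stable (hA : ∀ j, ClosedAlong j A) (hB : ∀ j, ClosedAlong j B)
    (hsA : Pi.single s 1 ∈ A) (hsB : Pi.single s 1 ∈ B) (hs : s ≠ o)
    (hst : ∀ j, j ≠ o → j ≠ s → ∀ M,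
        (Pi.single j 1 ∈ A ∧ Pi.single s M ∈ A) ∨ (Pi.single j 1 ∈ B ∧ Pi.single s M ∈ B) →
        ClosedAlong j (A.image (shear s j M)))
    {x : ι → ℕ} (hx : x ∈ A) {j : ι} (hjo : j ≠ o) (hjs : j ≠ s) (hxj : 1 ≤ x j) :
    ∀ i, i ≠ o → x i = (Pi.single j 1 : ι → ℕ) i := by
  obtain ⟨k, hk⟩ := exists_single_mem_iff hA s
  obtain ⟨l, hl⟩ := exists_single_mem_iff hB s
  have hk1 := (hk 1).1 hsA
  have hl1 := (hl 1).1 hsB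
  have key : ∀ x ∈ A, ∀ j, j ≠ o → j ≠ s → 1 ≤ x j →
      x s = 0 ∧ ∃ M, 1 ≤ M ∧ update (update x j (x j - 1)) s (x s + M) ∈ A := by
    intro x hx j hjo hjs hxj
    have hjA : Pi.single j 1 ∈ A := mem_of_le_of_closedAlong hA hx (by
      intro i
      by_cases hi : i = j
      · subst hi; simpa using hxj
      · simp [hi])
    -- `M` is the last index on the `s`-axis of `A`, or of `B` if that axis is longer and `e_j` is
    -- also in `B`. Since `A` has no axis point beyond `k - 1 ≤ M`, moving `x` by `M` along `s`
    -- leaves room only for `x s = 0`.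
    obtain ⟨M, hM1, hMk, hM⟩ : ∃ M, 1 ≤ M ∧ k ≤ M + 1 ∧
        ((Pi.single j 1 ∈ A ∧ Pi.single s M ∈ A) ∨
          (Pi.single j 1 ∈ B ∧ Pi.single s M ∈ B)) := by
      by_cases hlk : l ≤ k ∨ Pi.single j 1 ∉ B
      · exact ⟨k - 1, by omega, by omega, Or.inl ⟨hjA, (hk _).2 (by omega)⟩⟩
      · rw [not_or, not_not] at hlk
        exact ⟨l - 1, by omega, by omega, Or.inr ⟨hlk.2, (hl _).2 (by omega)⟩⟩
    have hmem := mem_of_closedAlong_image_shear hjs (hst j hjo hjs M hM) hx hxj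
    have hsingle : (Pi.single s (x s + M) : ι → ℕ) ∈ A := mem_of_le_of_closedAlong hA hmem (by
      intro i
      by_cases hi : i = s
      · subst hi; simp
      · simp [hi])
    have := (hk _).1 hsingle
    exact ⟨by omega, M, hM1, hmem⟩
  -- The point `x - e_j + M e_s` lies in `A` and has positive `s`-coordinate. A further nonzero
  -- coordinate off `o` and `s` would, by `key` again, force that `s`-coordinate to be 0.
  obtain ⟨hxs, M, hM, hmem⟩ := key x hx j hjo hjs hxj
  have hzero : ∀ i, i ≠ o → i ≠ s → update (update x j (x j - 1)) s (x s + M) i = 0 := by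
    intro i hio his
    by_contra hne
    have := (key _ hmem i hio his (Nat.one_le_iff_ne_zero.2 hne)).1
    simp at this
    omega
  intro i hio
  by_cases his : i = s
  · subst his; simp [hxs, hjs]
  · have := hzero i hio his
    by_cases hij : i = j
    · subst hij
      simp [his] at this ⊢
      omega
    · simpa [his, hij] using this

end Minimal

/-! ### Counting inequalities for heights over lines. -/

section Counting

/-- A one-dimensional sumset bound in terms of average heights. Induct on both lengths: average the
bounds without the last `a` and without the last `b`, then add the top term `h (k + l + 2) ≥ a (k +
1) + b (l + 1)`. -/
theorem sum_line_le (k l : ℕ) (a b h : ℕ → ℝ)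
    (hh : ∀ i ≤ k, ∀ j ≤ l, a i + b j ≤ h (i + j)) :
    ((k : ℝ) + l + 1) * ((∑ i ∈ Finset.range (k + 1), a i) / (k + 1) +
      (∑ j ∈ Finset.range (l + 1), b j) / (l + 1)) ≤
      ∑ n ∈ Finset.range (k + l + 1), h n := by
  induction k generalizing l with
  | zero =>
    have h1 : ∑ j ∈ Finset.range (l + 1), (a 0 + b j) ≤ ∑ n ∈ Finset.range (0 + l + 1), h n := by
      rw [Nat.zero_add]
      refine Finset.sum_le_sum fun j hj => ?_
      simpa using hh 0 le_rfl j (by simpa [Nat.lt_succ_iff] using hj)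
    refine le_trans (le_of_eq ?_) h1
    have : (l : ℝ) + 1 ≠ 0 := by positivity
    rw [Finset.sum_add_distrib]
    simp
    field_simp
  | succ k ihk =>
    induction l with
    | zero =>
      have h1 : ∑ j ∈ Finset.range (k + 1 + 1), (a j + b 0) ≤
          ∑ n ∈ Finset.range (k + 1 + 0 + 1), h n := by
        refine Finset.sum_le_sum fun j hj => ?_
        simpa using hh j (by simpa [Nat.lt_succ_iff] using hj) 0 le_rfl
      refine le_trans (le_of_eq ?_) h1
      have : (k : ℝ) + 1 + 1 ≠ 0 := by positivity
      rw [Finset.sum_add_distrib]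
      simp
      field_simp
    | succ l ihl =>
      have h1 := ihk (l + 1) (fun i hi j hj => hh i (by omega) j hj)
      have h2 := ihl (fun i hi j hj => hh i hi j (by omega))
      have h3 := hh (k + 1) le_rfl (l + 1) le_rfl
      have e1 : k + (l + 1) + 1 = k + 1 + (l + 1) := by omega
      have e2 : k + 1 + l + 1 = k + 1 + (l + 1) := by omega
      rw [e1] at h1
      rw [e2] at h2
      rw [Finset.sum_range_succ _ (k + 1 + (l + 1)), Finset.sum_range_succ a (k + 1),
        Finset.sum_range_succ b (l + 1)]
      rw [Finset.sum_range_succ b (l + 1)] at h1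
      rw [Finset.sum_range_succ a (k + 1)] at h2
      set T := ∑ n ∈ Finset.range (k + 1 + (l + 1)), h n
      set X := ∑ i ∈ Finset.range (k + 1), a i
      set Y := ∑ i ∈ Finset.range (l + 1), b i
      push_cast at h1 h2 ⊢
      have hK : (0 : ℝ) < (k : ℝ) + 1 := by positivity
      have hL : (0 : ℝ) < (l : ℝ) + 1 := by positivity
      generalize (k : ℝ) = κ at *
      generalize (l : ℝ) = μ at *
      generalize h (k + 1 + (l + 1)) = hz at *
      generalize a (k + 1) = x at *
      generalize b (l + 1) = y at *
      have hKL : (0 : ℝ) < (κ + 1) + (μ + 1) := by positivity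
      -- The weights `k + 1` and `l + 1` of the two inductive bounds make the combination an exact
      -- identity.
      have g1 := mul_le_mul_of_nonneg_left h1 hK.le
      have g2 := mul_le_mul_of_nonneg_left h2 hL.le
      have key : ((κ + 1) + (μ + 1)) * ((κ + 1 + (μ + 1) + 1) * ((X + x) / (κ + 1 + 1) +
          (Y + y) / (μ + 1 + 1)) - x - y) ≤ ((κ + 1) + (μ + 1)) * T := by
        refine le_trans (le_of_eq ?_) (le_trans (add_le_add g1 g2) (le_of_eq (by ring)))
        have : κ + 1 + 1 ≠ 0 := by positivity
        have : μ + 1 + 1 ≠ 0 := by positivity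
        field_simp
        ring
      have := le_of_mul_le_mul_left key hKL
      linarith

variable {ι : Type*} [Fintype ι] [DecidableEq ι] {o s : ι} {A B : Finset (ι → ℕ)}

/-- Distinct representatives with `o`-coordinate 0 lie on disjoint lines. -/
theorem sum_card_fiber_le {α : Type*} (D : Finset (ι → ℕ)) (Q : Finset α) (z : α → ι → ℕ)
    (h0 : ∀ q ∈ Q, z q o = 0) (hinj : Set.InjOn z Q) :
    ∑ q ∈ Q, (fiber o D (z q)).card ≤ D.card := by
  classical
  rw [← Finset.card_biUnion]
  · exact Finset.card_le_card (Finset.biUnion_subset.2 fun q _ => Finset.filter_subset _ _)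
  · intro q hq q' hq' hne
    rw [onFun, Finset.disjoint_left]
    intro x hx hx'
    refine hne (hinj hq hq' (funext fun k => ?_))
    by_cases hk : k = o
    · rw [hk, h0 q hq, h0 q' hq']
    · rw [← (mem_fiber.1 hx).2 k hk, ← (mem_fiber.1 hx').2 k hk]

theorem card_eq_sum_base (h : ClosedAlong o A) :
    A.card = ∑ x ∈ base o A, (fiber o A x).card := by
  classical
  refine le_antisymm ?_ (sum_card_fiber_le A (base o A) id (fun q hq => (mem_base.1 hq).2)
    injective_id.injOn)
  rw [← Finset.card_biUnion]
  · refine Finset.card_le_card fun x hx => Finset.mem_biUnion.2 ⟨update x o 0, ?_, ?_⟩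
    · exact mem_base.2 ⟨by simpa using h x hx 0 (by simp), by simp⟩
    · rw [fiber_update]; exact self_mem_fiber hx
  · intro x hx y hy hne
    rw [onFun, Finset.disjoint_left]
    intro w hw hw'
    refine hne (funext fun k => ?_)
    by_cases hk : k = o
    · rw [hk, (mem_base.1 hx).2, (mem_base.1 hy).2]
    · rw [← (mem_fiber.1 hw).2 k hk, ← (mem_fiber.1 hw').2 k hk]

theorem card_fiber_add_of_mem {x y : ι → ℕ} (hx : x ∈ A) (hy : y ∈ B) :
    ((fiber o A x).card : ℝ) + (fiber o B y).card ≤ (fiber o (A + B) (x + y)).card + 1 := by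
  exact_mod_cast card_fiber_add ⟨x, self_mem_fiber hx⟩ ⟨y, self_mem_fiber hy⟩

/-- The coordinates other than `o` and `s` in which `A` contains the unit vector. -/
def units (o s : ι) (A : Finset (ι → ℕ)) : Finset ι :=
  Finset.univ.filter (fun j => j ≠ o ∧ j ≠ s ∧ Pi.single j 1 ∈ A)

theorem mem_units {j : ι} : j ∈ units o s A ↔ j ≠ o ∧ j ≠ s ∧ Pi.single j 1 ∈ A := by
  simp [units]

/-- Up to the coordinate `o`, the set `A` consists of `k` consecutive points on the axis `s` and of
unit vectors. -/
structure IsLongSimplex (o s : ι) (k : ℕ) (A : Finset (ι → ℕ)) : Prop where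
  closed : ClosedAlong o A
  single_mem_iff : ∀ n, Pi.single s n ∈ A ↔ n < k
  apply_eq : ∀ x ∈ A, ∀ j, j ≠ o → j ≠ s → 1 ≤ x j →
    ∀ i, i ≠ o → x i = (Pi.single j 1 : ι → ℕ) i

theorem IsLongSimplex.sum_base {k : ℕ} (h : IsLongSimplex o s k A) (hs : s ≠ o)
    {M : Type*} [AddCommMonoid M] (f : (ι → ℕ) → M) :
    ∑ x ∈ base o A, f x = ∑ n ∈ Finset.range k, f (Pi.single s n) +
      ∑ j ∈ units o s A, f (Pi.single j 1) := by
  have hbase : base o A = (Finset.range k).image (fun n => Pi.single s n) ∪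
      (units o s A).image (fun j => Pi.single j 1) := by
    ext x
    simp only [mem_base, Finset.mem_union, Finset.mem_image, Finset.mem_range, mem_units]
    constructor
    · rintro ⟨hx, hxo⟩
      by_cases hj : ∃ j, j ≠ o ∧ j ≠ s ∧ 1 ≤ x j
      · obtain ⟨j, hjo, hjs, hxj⟩ := hj
        have : Pi.single j 1 = x := by
          funext i
          by_cases hi : i = o
          · subst hi; simp [hxo, hjo]
          · exact (h.apply_eq x hx j hjo hjs hxj i hi).symm
        exact Or.inr ⟨j, ⟨hjo, hjs, this ▸ hx⟩, this⟩
      · push Not at hj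
        have : Pi.single s (x s) = x := by
          funext i
          by_cases his : i = s
          · subst his; simp
          · by_cases hio : i = o
            · subst hio; simp [hxo, his]
            · have := hj i hio his
              simp [his]; omega
        exact Or.inl ⟨x s, (h.single_mem_iff _).1 (by rw [this]; exact hx), this⟩
    · rintro (⟨n, hn, rfl⟩ | ⟨j, ⟨hjo, _, hj⟩, rfl⟩)
      · exact ⟨(h.single_mem_iff n).2 hn, by simp [hs.symm]⟩
      · exact ⟨hj, by simp [hjo.symm]⟩
  rw [hbase, Finset.sum_union, Finset.sum_image (Pi.single_injective s).injOn, Finset.sum_image]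
  · intro i _ j _ hij
    by_contra hne
    have := congrFun hij i
    simp [hne] at this
  · rw [Finset.disjoint_left]
    intro x hx hx'
    obtain ⟨n, _, rfl⟩ := Finset.mem_image.1 hx
    obtain ⟨j, hj, hjn⟩ := Finset.mem_image.1 hx'
    have := congrFun hjn j
    simp [(mem_units.1 hj).2.1] at this

/-- The pairs `(i, j)` and `(j, i)` have the same sum when both indices lie in `C = I ∩ J`, so only
one is kept. By symmetry the kept part of `C × C` carries half of the total over `C × C` plus half
of the diagonal; the subtracted term is the resulting deficit `(|C| - 1)/2`. -/
theorem sum_pairs_ge (I J : Finset ι) (e : ι → ℕ) (he : Injective e) (a b : ι → ℝ)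
    (H : ι → ι → ℝ) (hsymm : ∀ i j, H i j = H j i) (hH : ∀ i ∈ I, ∀ j ∈ J, a i + b j ≤ H i j) :
    (J.card : ℝ) * ∑ i ∈ I, a i + I.card * ∑ j ∈ J, b j -
      (((I ∩ J).card : ℝ) - 1) / 2 * (∑ i ∈ I ∩ J, a i + ∑ i ∈ I ∩ J, b i) ≤
    ∑ p ∈ (I ×ˢ J).filter (fun p => ¬ (p.1 ∈ J ∧ p.2 ∈ I ∧ e p.2 < e p.1)), H p.1 p.2 := by
  set C := I ∩ J with hC
  have hCI : C ⊆ I := Finset.inter_subset_left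
  have hCJ : C ⊆ J := Finset.inter_subset_right
  have hCC : C ×ˢ C ⊆ I ×ˢ J := Finset.product_subset_product hCI hCJ
  set U := (C ×ˢ C).filter (fun p => e p.1 ≤ e p.2) with hU
  set U' := (C ×ˢ C).filter (fun p => e p.2 ≤ e p.1) with hU'
  have hV : (I ×ˢ J).filter (fun p => ¬ (p.1 ∈ J ∧ p.2 ∈ I ∧ e p.2 < e p.1)) =
      ((I ×ˢ J) \ (C ×ˢ C)) ∪ U := by
    ext p
    simp only [Finset.mem_filter, Finset.mem_product, Finset.mem_union, Finset.mem_sdiff, hU, hC,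
      Finset.mem_inter, not_and, not_lt]
    tauto
  have hdisj : Disjoint ((I ×ˢ J) \ (C ×ˢ C)) U :=
    Finset.disjoint_of_subset_right (Finset.filter_subset _ _) Finset.sdiff_disjoint
  have hprod : ∀ S T : Finset ι, ∑ p ∈ S ×ˢ T, (a p.1 + b p.2) =
      T.card * ∑ i ∈ S, a i + S.card * ∑ j ∈ T, b j := fun S T => by
    rw [Finset.sum_product]
    simp [Finset.sum_add_distrib, Finset.mul_sum]
  have h1 : ∑ p ∈ (I ×ˢ J) \ (C ×ˢ C), (a p.1 + b p.2) ≤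
      ∑ p ∈ (I ×ˢ J) \ (C ×ˢ C), H p.1 p.2 := Finset.sum_le_sum fun p hp => by
    have := Finset.mem_product.1 (Finset.mem_sdiff.1 hp).1
    exact hH _ this.1 _ this.2
  have h2 := Finset.sum_sdiff (f := fun p : ι × ι => a p.1 + b p.2) hCC
  have h3 : ∑ p ∈ U', H p.1 p.2 = ∑ p ∈ U, H p.1 p.2 := by
    refine Finset.sum_nbij' Prod.swap Prod.swap ?_ ?_ ?_ ?_ ?_
    · intro p; simp [hU, hU']; tauto
    · intro p; simp [hU, hU']; tauto
    · simp
    · simp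
    · intro p _; exact hsymm _ _
  have h4 : U ∪ U' = C ×ˢ C := by
    ext p
    simp only [hU, hU', Finset.mem_union, Finset.mem_filter]
    have := le_total (e p.1) (e p.2)
    tauto
  have h5 : U ∩ U' = C.image (fun i => (i, i)) := by
    ext ⟨i, j⟩
    simp only [hU, hU', Finset.mem_inter, Finset.mem_filter, Finset.mem_product, Finset.mem_image,
      Prod.mk.injEq]
    constructor
    · rintro ⟨⟨⟨hi, hj⟩, h⟩, _, h'⟩
      exact ⟨i, hi, rfl, he (le_antisymm h h')⟩
    · rintro ⟨c, hc, rfl, rfl⟩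
      simp [hc]
  -- `U` and its mirror image `U'` cover `C × C` and meet in the diagonal.
  have h6 := Finset.sum_union_inter (s₁ := U) (s₂ := U') (f := fun p : ι × ι => H p.1 p.2)
  rw [h4, h5, h3, Finset.sum_image (by intro i _ j _ h; simpa using h)] at h6
  have h7 : ∑ p ∈ C ×ˢ C, (a p.1 + b p.2) ≤ ∑ p ∈ C ×ˢ C, H p.1 p.2 :=
    Finset.sum_le_sum fun p hp => by
      have := Finset.mem_product.1 hp
      exact hH _ (hCI this.1) _ (hCJ this.2)
  have h8 : ∑ i ∈ C, (a i + b i) ≤ ∑ i ∈ C, H i i :=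
    Finset.sum_le_sum fun i hi => hH _ (hCI hi) _ (hCJ hi)
  rw [hprod] at h2 h7
  rw [Finset.sum_add_distrib] at h8
  rw [hV, Finset.sum_union hdisj]
  rw [hprod] at h2
  nlinarith

/-- Here `α₀`, `s₁`, `s₃` are the masses of `A` over the axis, over the units of `A` alone and over
the shared units, and `β₀`, `t₂`, `t₃` those of `B`. The difference of the two sides is an explicit
sum of nonnegative terms; `k, l ≥ 2` is needed for the shared units. -/
theorem long_simplex_numeric {k l n₁ n₂ n₃ α₀ β₀ s₁ s₃ t₂ t₃ : ℝ} (hk : 2 ≤ k) (hl : 2 ≤ l)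
    (hn₂ : 0 ≤ n₂) (hn₃ : 0 ≤ n₃) (hβ₀ : 0 ≤ β₀) (hs₁ : 0 ≤ s₁)
    (hs₃ : 0 ≤ s₃) (ht₂ : 0 ≤ t₂) (ht₃ : 0 ≤ t₃) (h : β₀ + t₂ + t₃ ≤ α₀ + s₁ + s₃) :
    (α₀ + s₁ + s₃) + (n₁ + n₂ + n₃ + 3 - 1 / k - 1 / l) * (β₀ + t₂ + t₃) ≤
      (k + l - 1) * (α₀ / k + β₀ / l) + (n₁ * β₀ + l * s₁) + (n₂ * α₀ + k * t₂) +
      (n₃ * (α₀ + β₀) + l * s₃ + k * t₃) / 2 +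
      ((n₂ + n₃) * (s₁ + s₃) + (n₁ + n₃) * (t₂ + t₃) - (n₃ - 1) / 2 * (s₃ + t₃)) := by
  have hk0 : (0 : ℝ) < k := by linarith
  have hl0 : (0 : ℝ) < l := by linarith
  have hp : 1 / k ≤ 1 / 2 := one_div_le_one_div_of_le (by norm_num) hk
  have hq : 1 / l ≤ 1 / 2 := one_div_le_one_div_of_le (by norm_num) hl
  have key : (k + l - 1) * (α₀ / k + β₀ / l) + (n₁ * β₀ + l * s₁) + (n₂ * α₀ + k * t₂) +
      (n₃ * (α₀ + β₀) + l * s₃ + k * t₃) / 2 +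
      ((n₂ + n₃) * (s₁ + s₃) + (n₁ + n₃) * (t₂ + t₃) - (n₃ - 1) / 2 * (s₃ + t₃)) =
      (α₀ + s₁ + s₃) + (n₁ + n₂ + n₃ + 3 - 1 / k - 1 / l) * (β₀ + t₂ + t₃) +
      ((k - l) ^ 2 / (k * l)) * (β₀ + t₂ + t₃) +
      ((l - 1) / k + n₂ + n₃ / 2) * ((α₀ + s₁ + s₃) - (β₀ + t₂ + t₃)) +
      s₁ * ((l - 1) * (1 - 1 / k) + n₃ / 2) + s₃ * ((l - 1) * (1 / 2 - 1 / k)) +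
      t₂ * ((k - 1) * (1 - 1 / l) + n₃ / 2) + t₃ * ((k - 1) * (1 / 2 - 1 / l)) := by
    field_simp
    ring
  rw [key]
  have e1 : 0 ≤ ((k - l) ^ 2 / (k * l)) * (β₀ + t₂ + t₃) := by positivity
  have e2 : 0 ≤ ((l - 1) / k + n₂ + n₃ / 2) * ((α₀ + s₁ + s₃) - (β₀ + t₂ + t₃)) := by
    have : 0 ≤ (l - 1) / k := div_nonneg (by linarith) hk0.le
    exact mul_nonneg (by positivity) (by linarith)
  have e3 : 0 ≤ s₁ * ((l - 1) * (1 - 1 / k) + n₃ / 2) :=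
    mul_nonneg hs₁ (add_nonneg (mul_nonneg (by linarith) (by linarith)) (by linarith))
  have e4 : 0 ≤ s₃ * ((l - 1) * (1 / 2 - 1 / k)) :=
    mul_nonneg hs₃ (mul_nonneg (by linarith) (by linarith))
  have e5 : 0 ≤ t₂ * ((k - 1) * (1 - 1 / l) + n₃ / 2) :=
    mul_nonneg ht₂ (add_nonneg (mul_nonneg (by linarith) (by linarith)) (by linarith))
  have e6 : 0 ≤ t₃ * ((k - 1) * (1 / 2 - 1 / l)) :=
    mul_nonneg ht₃ (mul_nonneg (by linarith) (by linarith))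
  linarith

end Counting

/-! ### Lower bound for the sumset of two long simplices. -/

section LongSimplex

variable {ι : Type*} [Fintype ι] [DecidableEq ι] {o s : ι} {A B : Finset (ι → ℕ)}

/-- The points of the sumset of two long simplices over which the heights are counted. -/
def simplexPoint (s : ι) : ℕ ⊕ (Σ _ : ι, ℕ) ⊕ (ι × ι) → ι → ℕ :=
  Sum.elim (fun n => Pi.single s n)
    (Sum.elim (fun p => Pi.single p.1 1 + Pi.single s p.2)
      (fun p => Pi.single p.1 1 + Pi.single p.2 1))

theorem injOn_simplexPoint (L : Finset ℕ) (K : Finset (Σ _ : ι, ℕ)) (V : Finset (ι × ι))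
    (hK : ∀ p ∈ K, p.1 ≠ s) (hV : ∀ p ∈ V, p.1 ≠ s ∧ p.2 ≠ s)
    (hV' : ∀ p ∈ V, p.swap ∈ V → p.1 = p.2) :
    Set.InjOn (simplexPoint s) (L.disjSum (K.disjSum V)) := by
  -- The coordinate sum off `s` is 0, 1 or 2 and separates the three families.
  have hlev : ∀ q ∈ L.disjSum (K.disjSum V), ∑ j ∈ Finset.univ.erase s, simplexPoint s q j =
      Sum.elim (fun _ => 0) (Sum.elim (fun _ => 1) (fun _ => 2)) q := by
    have hs : ∀ n, ∑ j ∈ Finset.univ.erase s, (Pi.single s n : ι → ℕ) j = 0 := fun n =>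
      Finset.sum_eq_zero fun j hj => by simp [Finset.ne_of_mem_erase hj]
    have hj : ∀ j, j ≠ s → ∑ i ∈ Finset.univ.erase s, (Pi.single j 1 : ι → ℕ) i = 1 :=
      fun j hj => by
        simp [Pi.single_apply, hj]
    rintro (n | p | p) hq
    · exact hs n
    · have := hK p (by simpa using hq)
      simp only [simplexPoint, Sum.elim_inr, Sum.elim_inl, Pi.add_apply, Finset.sum_add_distrib,
        hs, hj _ this]
    · have := hV p (by simpa using hq)
      simp only [simplexPoint, Sum.elim_inr, Pi.add_apply, Finset.sum_add_distrib,
        hj _ this.1, hj _ this.2]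
  intro q hq q' hq' h
  have hl := hlev q hq
  rw [h, hlev q' hq'] at hl
  rcases q with n | p | p <;> rcases q' with n' | p' | p' <;> simp at hl
  · have := congrFun h s
    simpa [simplexPoint] using this
  · have hp := hK p (by simpa using hq)
    have hp' := hK p' (by simpa using hq')
    have h1 := congrFun h s
    have h2 := congrFun h p.1
    obtain ⟨i, n⟩ := p
    obtain ⟨i', n'⟩ := p'
    simp only [simplexPoint, Sum.elim_inr, Sum.elim_inl, Pi.add_apply, Pi.single_apply] at h1 h2
    simp only [hp, hp.symm, hp'.symm, if_true, if_false] at h1 h2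
    have : i = i' := by
      by_contra hne
      simp [hne] at h2
    subst this
    simp at h1
    simp [h1]
  · have hp := hV p (by simpa using hq)
    have hp' := hV p' (by simpa using hq')
    obtain ⟨i, j⟩ := p
    obtain ⟨i', j'⟩ := p'
    have h1 := congrFun h i
    have h2 := congrFun h j
    have hsw : i = j' → j = i' → i = j := fun e1 e2 => by
      subst e1 e2
      exact hV' (i, j) (by simpa using hq) (by simpa using hq')
    simp only [simplexPoint, Sum.elim_inr, Pi.add_apply, Pi.single_apply] at h1 h2
    by_cases e1 : i = i'
    · by_cases e2 : j = j'
      · rw [e1, e2]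
      · subst e1
        simp [e2] at h2
    · by_cases e2 : i = j'
      · by_cases e3 : j = i'
        · have := hsw e2 e3
          exact absurd (this.trans e3) e1
        · subst e2
          exfalso
          simp [e3] at h2
      · exfalso
        simp [e1, e2] at h1

theorem row_le (c : ℝ) (b h : ℕ → ℝ) (h0 : ∀ n, 0 ≤ h n) {l t : ℕ} (hlt : l ≤ t)
    (hh : ∀ n < l, c + b n ≤ h n + 1) :
    l * c + ∑ n ∈ Finset.range l, b n ≤ (∑ n ∈ Finset.range t, h n) + t := by
  calc l * c + ∑ n ∈ Finset.range l, b n = ∑ n ∈ Finset.range l, (c + b n) := by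
        simp [Finset.sum_add_distrib]
    _ ≤ ∑ n ∈ Finset.range l, (h n + 1) :=
        Finset.sum_le_sum fun n hn => hh n (Finset.mem_range.1 hn)
    _ ≤ ∑ n ∈ Finset.range t, (h n + 1) :=
        Finset.sum_le_sum_of_subset_of_nonneg (Finset.range_mono hlt) fun n _ _ =>
          add_nonneg (h0 n) zero_le_one
    _ = _ := by simp [Finset.sum_add_distrib]

/-- The number of points counted on the line through the unit vector `j`. -/
def rowLength (I J : Finset ι) (k l : ℕ) (j : ι) : ℕ :=
  max (if j ∈ I then l else 0) (if j ∈ J then k else 0)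

/-- The pairs of unit vectors whose sums are counted: of two pairs with the same sum only one is
taken. -/
def unitPairs (e : ι → ℕ) (I J : Finset ι) : Finset (ι × ι) :=
  (I ×ˢ J).filter (fun p => ¬ (p.1 ∈ J ∧ p.2 ∈ I ∧ e p.2 < e p.1))

/-- The numerical core, for arbitrary heights: `a₀`, `b₀` over the axis, `a₁`, `b₁` over the units,
and `hL`, `hR`, `hV` over the axis, rows and pair sums of the sumset. Each `+ 1` in the hypotheses
is the loss on one line, so the total loss is the number of lines counted. -/
theorem long_simplex_weights (I J : Finset ι) (e : ι → ℕ) (he : Injective e) {k l : ℕ}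
    (hk : 2 ≤ k) (hl : 2 ≤ l) (a₀ b₀ : ℕ → ℝ) (a₁ b₁ : ι → ℝ) (hL : ℕ → ℝ) (hR : ι → ℕ → ℝ)
    (hV : ι → ι → ℝ) (hb₀ : ∀ n, 0 ≤ b₀ n) (ha₁ : ∀ j, 0 ≤ a₁ j)
    (hb₁ : ∀ j, 0 ≤ b₁ j) (hR₀ : ∀ j n, 0 ≤ hR j n) (hsymm : ∀ i j, hV i j = hV j i)
    (h₁ : ∀ n < k, ∀ m < l, a₀ n + b₀ m ≤ hL (n + m) + 1)
    (h₂ : ∀ j ∈ I, ∀ n < l, a₁ j + b₀ n ≤ hR j n + 1)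
    (h₃ : ∀ j ∈ J, ∀ n < k, b₁ j + a₀ n ≤ hR j n + 1)
    (h₄ : ∀ i ∈ I, ∀ j ∈ J, a₁ i + b₁ j ≤ hV i j + 1)
    {α β T : ℝ} (hα : α = ∑ n ∈ Finset.range k, a₀ n + ∑ j ∈ I, a₁ j)
    (hβ : β = ∑ n ∈ Finset.range l, b₀ n + ∑ j ∈ J, b₁ j) (hαβ : β ≤ α)
    (hT : (∑ n ∈ Finset.range (k + l - 1), hL n) +
      ((∑ j ∈ I ∪ J, ∑ n ∈ Finset.range (rowLength I J k l j), hR j n) +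
      ∑ p ∈ unitPairs e I J, hV p.1 p.2) ≤ T) :
    α + (((I ∪ J).card : ℝ) + 3 - 1 / k - 1 / l) * β -
      (((I ∪ J).card : ℝ) + 1) * ((k + I.card) + (l + J.card)) ≤ T := by
  have hline : ((k : ℝ) + l - 1) * ((∑ n ∈ Finset.range k, a₀ n) / k +
      (∑ n ∈ Finset.range l, b₀ n) / l) ≤
      (∑ n ∈ Finset.range (k + l - 1), hL n) + (k + l - 1 : ℝ) := by
    obtain ⟨k, rfl⟩ := Nat.exists_eq_add_of_le' (by omega : 1 ≤ k)
    obtain ⟨l, rfl⟩ := Nat.exists_eq_add_of_le' (by omega : 1 ≤ l)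
    have := sum_line_le k l a₀ b₀ (fun n => hL n + 1)
      (fun i hi j hj => h₁ i (by omega) j (by omega))
    rw [Finset.sum_add_distrib] at this
    have e1 : k + 1 + (l + 1) - 1 = k + l + 1 := by omega
    rw [e1]
    push_cast
    simp only [Finset.sum_const, Finset.card_range, nsmul_eq_mul, mul_one] at this
    push_cast at this
    convert this using 1 <;> ring
  obtain ⟨R, hRdef⟩ : ∃ R : ι → ℝ, ∀ j, R j =
    (∑ n ∈ Finset.range (rowLength I J k l j), hR j n) + rowLength I J k l j := ⟨_, fun _ => rfl⟩
  have hR1 : ∀ j ∈ I, l * a₁ j + ∑ n ∈ Finset.range l, b₀ n ≤ R j := by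
    intro j hj
    rw [hRdef]
    exact row_le _ _ _ (hR₀ j) (le_max_of_le_left (by rw [if_pos hj])) (h₂ j hj)
  have hR2 : ∀ j ∈ J, k * b₁ j + ∑ n ∈ Finset.range k, a₀ n ≤ R j := by
    intro j hj
    rw [hRdef]
    exact row_le _ _ _ (hR₀ j) (le_max_of_le_right (by rw [if_pos hj])) (h₃ j hj)
  have hpairs := sum_pairs_ge I J e he a₁ b₁ (fun i j => hV i j + 1)
    (fun i j => by rw [hsymm]) h₄
  change _ ≤ ∑ p ∈ unitPairs e I J, (hV p.1 p.2 + 1) at hpairs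
  rw [Finset.sum_add_distrib] at hpairs
  have hIdec : Disjoint (I \ J) (I ∩ J) := Finset.disjoint_sdiff_inter I J
  have hJdec : Disjoint (J \ I) (I ∩ J) := by
    rw [Finset.inter_comm]; exact Finset.disjoint_sdiff_inter J I
  have hIeq : I \ J ∪ I ∩ J = I := Finset.sdiff_union_inter I J
  have hJeq : J \ I ∪ I ∩ J = J := by rw [Finset.inter_comm]; exact Finset.sdiff_union_inter J I
  have hIJdec : Disjoint (I \ J) J := Finset.sdiff_disjoint
  have hIJeq : I \ J ∪ J = I ∪ J := Finset.sdiff_union_self_eq_union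
  have hsumI : ∀ f : ι → ℝ, ∑ j ∈ I, f j = ∑ j ∈ I \ J, f j + ∑ j ∈ I ∩ J, f j := fun f => by
    rw [← Finset.sum_union hIdec, hIeq]
  have hsumJ : ∀ f : ι → ℝ, ∑ j ∈ J, f j = ∑ j ∈ J \ I, f j + ∑ j ∈ I ∩ J, f j := fun f => by
    rw [← Finset.sum_union hJdec, hJeq]
  have hsumIJ : ∀ f : ι → ℝ, ∑ j ∈ I ∪ J, f j =
      ∑ j ∈ I \ J, f j + (∑ j ∈ J \ I, f j + ∑ j ∈ I ∩ J, f j) := fun f => by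
    rw [← hIJeq, Finset.sum_union hIJdec, hsumJ]
  have hcI : (I.card : ℝ) = (I \ J).card + (I ∩ J).card := by
    have := hsumI (fun _ => 1); simpa using this
  have hcJ : (J.card : ℝ) = (J \ I).card + (I ∩ J).card := by
    have := hsumJ (fun _ => 1); simpa using this
  have hcIJ : ((I ∪ J).card : ℝ) = (I \ J).card + ((J \ I).card + (I ∩ J).card) := by
    have := hsumIJ (fun _ => 1); simpa using this
  obtain ⟨α₀, hα₀⟩ : ∃ c, c = ∑ n ∈ Finset.range k, a₀ n := ⟨_, rfl⟩
  obtain ⟨β₀, hβ₀⟩ : ∃ c, c = ∑ n ∈ Finset.range l, b₀ n := ⟨_, rfl⟩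
  have hβ₀' : 0 ≤ β₀ := hβ₀ ▸ Finset.sum_nonneg fun n _ => hb₀ n
  rw [← hα₀] at hα hR2 hline
  rw [← hβ₀] at hβ hR1 hline
  have hrow1 : (I \ J).card * β₀ + l * ∑ j ∈ I \ J, a₁ j ≤ ∑ j ∈ I \ J, R j := by
    calc _ = ∑ j ∈ I \ J, (l * a₁ j + β₀) := by
          simp [Finset.sum_add_distrib, Finset.mul_sum]; ring
      _ ≤ _ := Finset.sum_le_sum fun j hj => hR1 j (Finset.mem_sdiff.1 hj).1
  have hrow2 : (J \ I).card * α₀ + k * ∑ j ∈ J \ I, b₁ j ≤ ∑ j ∈ J \ I, R j := by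
    calc _ = ∑ j ∈ J \ I, (k * b₁ j + α₀) := by
          simp [Finset.sum_add_distrib, Finset.mul_sum]; ring
      _ ≤ _ := Finset.sum_le_sum fun j hj => hR2 j (Finset.mem_sdiff.1 hj).1
  -- Over a shared unit the row can be bounded through `A` or through `B`; the mean of the two
  -- bounds is used.
  have hrow3 : ((I ∩ J).card * (α₀ + β₀) + l * ∑ j ∈ I ∩ J, a₁ j +
      k * ∑ j ∈ I ∩ J, b₁ j) / 2 ≤ ∑ j ∈ I ∩ J, R j := by
    calc _ = ∑ j ∈ I ∩ J, ((l * a₁ j + β₀) + (k * b₁ j + α₀)) / 2 := by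
          rw [← Finset.sum_div]
          simp [Finset.sum_add_distrib, Finset.mul_sum]; ring
      _ ≤ _ := Finset.sum_le_sum fun j hj => by
          have h1 := hR1 j (Finset.mem_inter.1 hj).1
          have h2 := hR2 j (Finset.mem_inter.1 hj).2
          linarith
  have hRsum : ∑ j ∈ I ∪ J, R j =
      (∑ j ∈ I ∪ J, ∑ n ∈ Finset.range (rowLength I J k l j), hR j n) +
      ∑ j ∈ I ∪ J, (rowLength I J k l j : ℝ) := by
    simp_rw [hRdef]
    rw [Finset.sum_add_distrib]
  have htsum : ∑ j ∈ I ∪ J, (rowLength I J k l j : ℝ) ≤ (I ∪ J).card * ((k : ℝ) + l) := by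
    calc ∑ j ∈ I ∪ J, (rowLength I J k l j : ℝ) ≤ ∑ j ∈ I ∪ J, ((k : ℝ) + l) :=
          Finset.sum_le_sum fun j _ => by
            have : rowLength I J k l j ≤ k + l := by
              unfold rowLength
              split_ifs <;> omega
            exact_mod_cast this
      _ = _ := by rw [Finset.sum_const, nsmul_eq_mul]
  have hVcard : ((unitPairs e I J).card : ℝ) ≤ (I ∪ J).card * J.card := by
    have h1 : (unitPairs e I J).card ≤ I.card * J.card := by
      rw [← Finset.card_product]; exact Finset.card_filter_le _ _
    have h2 : I.card * J.card ≤ (I ∪ J).card * J.card :=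
      Nat.mul_le_mul_right _ (Finset.card_le_card Finset.subset_union_left)
    exact_mod_cast h1.trans h2
  have hnum := long_simplex_numeric (k := k) (l := l) (n₁ := (I \ J).card) (n₂ := (J \ I).card)
    (n₃ := (I ∩ J).card) (α₀ := α₀) (β₀ := β₀) (s₁ := ∑ j ∈ I \ J, a₁ j)
    (s₃ := ∑ j ∈ I ∩ J, a₁ j) (t₂ := ∑ j ∈ J \ I, b₁ j)
    (t₃ := ∑ j ∈ I ∩ J, b₁ j) (by exact_mod_cast hk) (by exact_mod_cast hl)
    (by positivity) (by positivity) hβ₀' (Finset.sum_nonneg fun j _ => ha₁ j)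
    (Finset.sum_nonneg fun j _ => ha₁ j) (Finset.sum_nonneg fun j _ => hb₁ j)
    (Finset.sum_nonneg fun j _ => hb₁ j) (by
      rw [hα, hβ, hsumI, hsumJ] at hαβ
      linarith)
  rw [hsumI, hsumJ, hcJ, hcI] at hpairs
  rw [hsumIJ] at hRsum
  rw [hsumI] at hα
  rw [hsumJ] at hβ
  rw [hα, hβ]
  simp only [Finset.sum_const, nsmul_eq_mul, mul_one] at hpairs
  rw [hcJ] at hVcard ⊢
  rw [hcI]
  rw [hcIJ] at hVcard htsum ⊢
  -- With `n = |I ∪ J|`, at most `k + l - 1 + n (k + l) + n |J|` lines were counted. This is the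
  -- slack up to `(n + 1)(k + |I| + l + |J|)`.
  have hn : 0 ≤ (((I \ J).card : ℝ) + ((J \ I).card + (I ∩ J).card)) *
      ((I \ J).card + (I ∩ J).card) + ((I \ J).card + (I ∩ J).card) +
      ((J \ I).card + (I ∩ J).card) + 1 := by positivity
  linarith

theorem sum_simplexPoint_le (D : Finset (ι → ℕ)) (hs : s ≠ o) (I J : Finset ι)
    (hI : ∀ j ∈ I, j ≠ o ∧ j ≠ s) (hJ : ∀ j ∈ J, j ≠ o ∧ j ≠ s) (e : ι → ℕ) (he : Injective e)
    (k l m : ℕ) :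
    (∑ n ∈ Finset.range m, ((fiber o D (Pi.single s n)).card : ℝ)) +
      ((∑ j ∈ I ∪ J, ∑ n ∈ Finset.range (rowLength I J k l j),
        ((fiber o D (Pi.single j 1 + Pi.single s n)).card : ℝ)) +
      ∑ p ∈ unitPairs e I J, ((fiber o D (Pi.single p.1 1 + Pi.single p.2 1)).card : ℝ)) ≤
      D.card := by
  have hIJ : ∀ j ∈ I ∪ J, j ≠ o ∧ j ≠ s := fun j hj =>
    (Finset.mem_union.1 hj).elim (hI j) (hJ j)
  have hV : ∀ p ∈ unitPairs e I J, p.1 ∈ I ∧ p.2 ∈ J := fun p hp =>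
    Finset.mem_product.1 (Finset.mem_filter.1 hp).1
  have := sum_card_fiber_le (o := o) D ((Finset.range m).disjSum
    (((I ∪ J).sigma (fun j => Finset.range (rowLength I J k l j))).disjSum (unitPairs e I J)))
    (simplexPoint s) ?_ (injOn_simplexPoint _ _ _ ?_ ?_ ?_)
  · rw [Finset.sum_disjSum, Finset.sum_disjSum, Finset.sum_sigma] at this
    simp only [simplexPoint, Sum.elim_inl, Sum.elim_inr] at this
    exact_mod_cast this
  · rintro (n | p | p) hq
    · simp [simplexPoint, hs.symm]
    · rw [Finset.inr_mem_disjSum, Finset.inl_mem_disjSum, Finset.mem_sigma] at hq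
      simp [simplexPoint, hs.symm, (hIJ _ hq.1).1.symm]
    · rw [Finset.inr_mem_disjSum, Finset.inr_mem_disjSum] at hq
      simp [simplexPoint, (hI _ (hV p hq).1).1.symm, (hJ _ (hV p hq).2).1.symm]
  · exact fun p hp => (hIJ _ (Finset.mem_sigma.1 hp).1).2
  · exact fun p hp => ⟨(hI _ (hV p hp).1).2, (hJ _ (hV p hp).2).2⟩
  · intro p hp hp'
    obtain ⟨h1, h2⟩ := Finset.mem_filter.1 hp
    obtain ⟨h3, h4⟩ := Finset.mem_filter.1 hp'
    simp only [Finset.mem_product, Prod.fst_swap, Prod.snd_swap] at h1 h2 h3 h4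
    refine he (le_antisymm ?_ ?_)
    · by_contra hlt
      exact h2 ⟨h3.2, h3.1, not_le.1 hlt⟩
    · by_contra hlt
      exact h4 ⟨h1.2, h1.1, not_le.1 hlt⟩

theorem IsLongSimplex.card_eq {k : ℕ} (hA : IsLongSimplex o s k A) (hs : s ≠ o) :
    (A.card : ℝ) = ∑ n ∈ Finset.range k, ((fiber o A (Pi.single s n)).card : ℝ) +
      ∑ j ∈ units o s A, ((fiber o A (Pi.single j 1)).card : ℝ) := by
  rw [card_eq_sum_base hA.closed, hA.sum_base hs]
  push_cast
  rfl

theorem IsLongSimplex.card_base {k : ℕ} (hA : IsLongSimplex o s k A) (hs : s ≠ o) :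
    (base o A).card = k + (units o s A).card := by
  rw [Finset.card_eq_sum_ones, hA.sum_base hs]
  simp

/-- The lower bound for the sumset of two long simplices. -/
theorem IsLongSimplex.card_add_ge {k l : ℕ} (hA : IsLongSimplex o s k A)
    (hB : IsLongSimplex o s l B) (hs : s ≠ o) (hk : 2 ≤ k) (hl : 2 ≤ l)
    (hcard : B.card ≤ A.card) :
    (A.card : ℝ) + (((units o s A ∪ units o s B).card : ℝ) + 3 - 1 / k - 1 / l) * B.card -
      (((units o s A ∪ units o s B).card : ℝ) + 1) * ((base o A).card + (base o B).card) ≤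
      (A + B).card := by
  have he : Injective (fun i => (Fintype.equivFin ι i : ℕ)) := fun i j hij =>
    (Fintype.equivFin ι).injective (Fin.ext hij)
  have hsum : ∀ x ∈ A, ∀ y ∈ B, ((fiber o A x).card : ℝ) + (fiber o B y).card ≤
      (fiber o (A + B) (x + y)).card + 1 := fun x hx y hy => card_fiber_add_of_mem hx hy
  have htotal := sum_simplexPoint_le (A + B) hs (units o s A) (units o s B)
    (fun j hj => ⟨(mem_units.1 hj).1, (mem_units.1 hj).2.1⟩)
    (fun j hj => ⟨(mem_units.1 hj).1, (mem_units.1 hj).2.1⟩) _ he k l (k + l - 1)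
  generalize A + B = D at hsum htotal ⊢
  have h₁ : ∀ n < k, ∀ m < l, ((fiber o A (Pi.single s n)).card : ℝ) +
      (fiber o B (Pi.single s m)).card ≤ (fiber o D (Pi.single s (n + m))).card + 1 :=
    fun n hn m hm => by
      rw [Pi.single_add]
      exact hsum _ ((hA.single_mem_iff n).2 hn) _ ((hB.single_mem_iff m).2 hm)
  have h₂ : ∀ j ∈ units o s A, ∀ n < l, ((fiber o A (Pi.single j 1)).card : ℝ) +
      (fiber o B (Pi.single s n)).card ≤ (fiber o D (Pi.single j 1 + Pi.single s n)).card + 1 :=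
    fun j hj n hn => hsum _ (mem_units.1 hj).2.2 _ ((hB.single_mem_iff n).2 hn)
  have h₃ : ∀ j ∈ units o s B, ∀ n < k, ((fiber o B (Pi.single j 1)).card : ℝ) +
      (fiber o A (Pi.single s n)).card ≤ (fiber o D (Pi.single j 1 + Pi.single s n)).card + 1 :=
    fun j hj n hn => by
      rw [add_comm, add_comm (Pi.single j 1 : ι → ℕ)]
      exact hsum _ ((hA.single_mem_iff n).2 hn) _ (mem_units.1 hj).2.2
  have h₄ : ∀ i ∈ units o s A, ∀ j ∈ units o s B, ((fiber o A (Pi.single i 1)).card : ℝ) +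
      (fiber o B (Pi.single j 1)).card ≤ (fiber o D (Pi.single i 1 + Pi.single j 1)).card + 1 :=
    fun i hi j hj => hsum _ (mem_units.1 hi).2.2 _ (mem_units.1 hj).2.2
  have hsymm : ∀ i j : ι, ((fiber o D (Pi.single i 1 + Pi.single j 1)).card : ℝ) =
      (fiber o D (Pi.single j 1 + Pi.single i 1)).card := fun i j => by
    rw [add_comm (Pi.single i 1 : ι → ℕ)]
  have hnn : ∀ (C : Finset (ι → ℕ)) (x : ι → ℕ), (0 : ℝ) ≤ (fiber o C x).card :=
    fun C x => Nat.cast_nonneg _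
  have hcard' : (B.card : ℝ) ≤ A.card := by exact_mod_cast hcard
  have hcA := hA.card_eq hs
  have hcB := hB.card_eq hs
  rw [hA.card_base hs, hB.card_base hs, Nat.cast_add, Nat.cast_add]
  refine long_simplex_weights (units o s A) (units o s B) _ he hk hl
    (fun n => ((fiber o A (Pi.single s n)).card : ℝ))
    (fun n => ((fiber o B (Pi.single s n)).card : ℝ))
    (fun j => ((fiber o A (Pi.single j 1)).card : ℝ))
    (fun j => ((fiber o B (Pi.single j 1)).card : ℝ))
    (fun n => ((fiber o D (Pi.single s n)).card : ℝ))
    (fun j n => ((fiber o D (Pi.single j 1 + Pi.single s n)).card : ℝ))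
    (fun i j => ((fiber o D (Pi.single i 1 + Pi.single j 1)).card : ℝ))
    (fun n => hnn B _) (fun j => hnn A _) (fun j => hnn B _) (fun j n => hnn D _) ?_ ?_ ?_ ?_ ?_ ?_ ?_ ?_ ?_
  · exact hsymm
  · exact h₁
  · exact h₂
  · exact h₃
  · exact h₄
  · exact hcA
  · exact hcB
  · exact hcard'
  · exact htotal


end LongSimplex

/-! ### The bound for configurations in ℕ^d. -/

section NatBound

variable {ι : Type*} [Fintype ι] [DecidableEq ι] {o s : ι} {SA SB : Finset ι}
  {nA nB r₁ r₂ N : ℕ} {A B : Finset (ι → ℕ)}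

theorem IsConfig.exists_closed (h : IsConfig o SA SB nA nB r₁ r₂ N A B) :
    ∃ A' B' : Finset (ι → ℕ), IsConfig o SA SB nA nB r₁ r₂ N A' B' ∧
      ∀ j, ClosedAlong j A' ∧ ClosedAlong j B' := by
  let P : Set (Finset (ι → ℕ) × Finset (ι → ℕ)) := {p | IsConfig o SA SB nA nB r₁ r₂ N p.1 p.2}
  obtain ⟨⟨A₀, B₀⟩, h₀, hmin⟩ := WellFounded.has_min
    (measure (fun p : Finset (ι → ℕ) × Finset (ι → ℕ) =>
      offWeight o o p.1 + offWeight o o p.2)).wf P ⟨(A, B), h⟩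
  replace h₀ : IsConfig o SA SB nA nB r₁ r₂ N A₀ B₀ := h₀
  refine ⟨A₀, B₀, h₀, fun j => ?_⟩
  by_cases hjo : j = o
  · subst hjo; exact ⟨h₀.closed_left, h₀.closed_right⟩
  have : offWeight o o A₀ + offWeight o o B₀ ≤
      offWeight o o (compress j A₀) + offWeight o o (compress j B₀) :=
    not_lt.1 (hmin (compress j A₀, compress j B₀) (h₀.isConfig_compress hjo))
  have hA := offWeight_compress_le o o j A₀
  have hB := offWeight_compress_le o o j B₀
  exact ⟨closedAlong_of_offWeight_le hjo hjo (by omega),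
    closedAlong_of_offWeight_le hjo hjo (by omega)⟩

/-- In a down-set a coordinate whose unit vector is missing vanishes. Hence off `o` each coordinate
of `x + y` comes from `x` alone or from `y` alone, addition is injective on pairs of base points,
and all `r₁ r₂` lines can be counted. -/
theorem IsConfig.disjoint_bound (h : IsConfig o SA SB nA nB r₁ r₂ N A B)
    (hA : ∀ j, ClosedAlong j A) (hB : ∀ j, ClosedAlong j B)
    (hdisj : ∀ j, j ≠ o → ¬ (Pi.single j 1 ∈ A ∧ Pi.single j 1 ∈ B)) :
    r₂ * nA + r₁ * nB ≤ N + r₁ * r₂ := by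
  have hunit : ∀ (C : Finset (ι → ℕ)), (∀ j, ClosedAlong j C) → ∀ j, Pi.single j 1 ∉ C →
      ∀ x ∈ C, x j = 0 := fun C hC j hj x hx => by
    by_contra hne
    refine hj (mem_of_le_of_closedAlong hC hx fun i => ?_)
    by_cases hi : i = j
    · subst hi; simpa using Nat.one_le_iff_ne_zero.2 hne
    · simp [hi]
  have hinj : Set.InjOn (fun p : (ι → ℕ) × (ι → ℕ) => p.1 + p.2)
      (base o A ×ˢ base o B : Finset _) := by
    rintro ⟨x, y⟩ hp ⟨x', y'⟩ hp' hxy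
    simp only [Finset.coe_product, Set.mem_prod, Finset.mem_coe, mem_base] at hp hp'
    have hcoord : ∀ j, x j = x' j ∧ y j = y' j := fun j => by
      have hj : x j + y j = x' j + y' j := congrFun hxy j
      by_cases hjo : j = o
      · rw [hjo, hp.1.2, hp.2.2, hp'.1.2, hp'.2.2]
        exact ⟨rfl, rfl⟩
      · by_cases hjA : Pi.single j 1 ∈ A
        · have hjB : Pi.single j 1 ∉ B := fun hjB => hdisj j hjo ⟨hjA, hjB⟩
          have h1 := hunit B hB j hjB y hp.2.1
          have h2 := hunit B hB j hjB y' hp'.2.1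
          omega
        · have h1 := hunit A hA j hjA x hp.1.1
          have h2 := hunit A hA j hjA x' hp'.1.1
          omega
    exact Prod.ext (funext fun j => (hcoord j).1) (funext fun j => (hcoord j).2)
  have h1 := sum_card_fiber_le (o := o) (A + B) (base o A ×ˢ base o B) (fun p => p.1 + p.2)
    (fun p hp => by
      have := Finset.mem_product.1 hp
      simp [(mem_base.1 this.1).2, (mem_base.1 this.2).2]) hinj
  have h2 : ∑ p ∈ base o A ×ˢ base o B, ((fiber o A p.1).card + (fiber o B p.2).card) ≤
      ∑ p ∈ base o A ×ˢ base o B, ((fiber o (A + B) (p.1 + p.2)).card + 1) :=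
    Finset.sum_le_sum fun p hp => by
      have := Finset.mem_product.1 hp
      exact card_fiber_add ⟨_, self_mem_fiber (mem_base.1 this.1).1⟩
        ⟨_, self_mem_fiber (mem_base.1 this.2).1⟩
  have h3 : ∑ p ∈ base o A ×ˢ base o B, ((fiber o A p.1).card + (fiber o B p.2).card) =
      r₂ * nA + r₁ * nB := by
    rw [Finset.sum_product]
    simp only [Finset.sum_add_distrib, Finset.sum_const, smul_eq_mul]
    rw [← Finset.mul_sum, ← card_eq_sum_base h.closed_left, ← card_eq_sum_base h.closed_right,
      h.base_left, h.base_right, h.card_left, h.card_right]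
  have h4 := h.card_add
  rw [h3, Finset.sum_add_distrib] at h2
  simp only [Finset.sum_const, smul_eq_mul, mul_one, Finset.card_product, h.base_left,
    h.base_right] at h2
  omega

theorem disjoint_numeric {α β r₁ r₂ d c N : ℕ} (h : r₂ * α + r₁ * β ≤ N + r₁ * r₂)
    (hα : r₁ ≤ α) (hβ : r₂ ≤ β) (hβα : β ≤ α) (hd : 2 ≤ d) (hr₁ : d ≤ r₁) (hr₂ : 1 ≤ r₂)
    (hc₀ : 1 ≤ c) (hc : c ≤ r₂) :
    (α : ℝ) + ((d : ℝ) + 1 - 1 / ((r₁ : ℝ) - d + 2) - 1 / ((r₂ : ℝ) - c + 2)) * β -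
      ((d : ℝ) - 1) * ((r₁ : ℝ) + r₂) ≤ N := by
  have h' : (r₂ : ℝ) * α + r₁ * β ≤ N + r₁ * r₂ := by exact_mod_cast h
  have hα' : (r₁ : ℝ) ≤ α := by exact_mod_cast hα
  have hβ' : (r₂ : ℝ) ≤ β := by exact_mod_cast hβ
  have hβα' : (β : ℝ) ≤ α := by exact_mod_cast hβα
  have hd' : (2 : ℝ) ≤ d := by exact_mod_cast hd
  have hr₁' : (d : ℝ) ≤ r₁ := by exact_mod_cast hr₁
  have hr₂' : (1 : ℝ) ≤ r₂ := by exact_mod_cast hr₂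
  have hc' : (c : ℝ) ≤ r₂ := by exact_mod_cast hc
  have e₁ : 0 ≤ 1 / ((r₁ : ℝ) - d + 2) := by
    apply div_nonneg zero_le_one; linarith
  have e₂ : 0 ≤ 1 / ((r₂ : ℝ) - c + 2) := by
    apply div_nonneg zero_le_one; linarith
  have hβ0 : (0 : ℝ) ≤ β := by positivity
  rcases hr₁.lt_or_eq with hlt | heq
  · have hlt' : (d : ℝ) + 1 ≤ r₁ := by exact_mod_cast hlt
    have g₁ := mul_nonneg (sub_nonneg.2 hr₂') (sub_nonneg.2 hα')
    have g₂ := mul_nonneg (sub_nonneg.2 hlt') (sub_nonneg.2 hβ')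
    have g₃ := mul_nonneg (add_nonneg e₁ e₂) hβ0
    have g₄ : 0 ≤ (r₂ : ℝ) * (r₁ - 2) := mul_nonneg (by linarith) (by linarith)
    have g₅ : 0 ≤ ((d : ℝ) - 2) * r₁ := mul_nonneg (by linarith) (by linarith)
    nlinarith
  -- For `r₁ = d` the coefficient of `β` falls short by at most `1/2`. If `r₂ ≥ 2`, the surplus of
  -- `α ≥ β` makes up for it; if `r₂ = 1`, then `c = 1` and both fractions equal `1/2`, so nothing
  -- is missing.
  · have hd1 : (r₁ : ℝ) = d := by exact_mod_cast heq.symm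
    rw [hd1] at h' hα' ⊢
    have e₃ : 1 / ((d : ℝ) - d + 2) = 1 / 2 := by norm_num
    rw [e₃]
    rcases hr₂.lt_or_eq with hlt₂ | heq₂
    · have hlt₂' : (2 : ℝ) ≤ r₂ := by exact_mod_cast hlt₂
      have g₁ := mul_nonneg (by linarith : (0 : ℝ) ≤ r₂ - 3 / 2) (sub_nonneg.2 hα')
      have g₂ := mul_nonneg (sub_nonneg.2 hlt₂') (by linarith : (0 : ℝ) ≤ (d : ℝ) - 1)
      have g₃ := mul_nonneg e₂ hβ0
      nlinarith
    · have hc1 : (c : ℝ) = r₂ := by exact_mod_cast (by omega : c = r₂)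
      have hr2 : (r₂ : ℝ) = 1 := by exact_mod_cast heq₂.symm
      rw [hc1, hr2] at *
      have e₄ : 1 / ((1 : ℝ) - 1 + 2) = 1 / 2 := by norm_num
      rw [e₄]
      nlinarith

theorem card_base_le (o : ι) (A : Finset (ι → ℕ)) : (base o A).card ≤ A.card :=
  Finset.card_filter_le _ _

theorem IsConfig.isLongSimplex (h : IsConfig o SA SB nA nB r₁ r₂ N A B)
    (hA : ∀ j, ClosedAlong j A) (hB : ∀ j, ClosedAlong j B)
    (hsA : Pi.single s 1 ∈ A) (hsB : Pi.single s 1 ∈ B) (hs : s ≠ o)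
    (hst : ∀ j, j ≠ o → j ≠ s → ∀ M,
        (Pi.single j 1 ∈ A ∧ Pi.single s M ∈ A) ∨ (Pi.single j 1 ∈ B ∧ Pi.single s M ∈ B) →
        ClosedAlong j (A.image (shear s j M))) :
    ∃ k, 2 ≤ k ∧ IsLongSimplex o s k A := by
  obtain ⟨k, hk⟩ := exists_single_mem_iff hA s
  exact ⟨k, (hk 1).1 hsA, h.closed_left, hk, fun x hx j hjo hjs hxj =>
    apply_eq_single_of_stable hA hB hsA hsB hs hst hx hjo hjs hxj⟩

theorem IsConfig.bound (h : IsConfig o SA SB nA nB r₁ r₂ N A B) {d c : ℕ}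
    (hcard : Fintype.card ι = d) (hd : 2 ≤ d) (hr₁ : d ≤ r₁) (hBA : nB ≤ nA)
    (hc : SB.card + 1 ≤ c) (hcr : c ≤ r₂) :
    (nA : ℝ) + ((d : ℝ) + 1 - 1 / ((r₁ : ℝ) - d + 2) - 1 / ((r₂ : ℝ) - c + 2)) * nB -
      ((d : ℝ) - 1) * ((r₁ : ℝ) + r₂) ≤ N := by
  obtain ⟨A₁, B₁, h₁, hcl⟩ := h.exists_closed
  by_cases hex : ∃ s, s ≠ o ∧ Pi.single s 1 ∈ A₁ ∧ Pi.single s 1 ∈ B₁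
  · obtain ⟨s, hs, hsA, hsB⟩ := hex
    obtain ⟨A₂, B₂, h₂, hsA, hsB, hcl, hst⟩ := h₁.exists_stable hs hsA hsB
    obtain ⟨k, hk, hlA⟩ := h₂.isLongSimplex (fun j => (hcl j).1) (fun j => (hcl j).2) hsA hsB hs
      (fun j hjo hjs M hM => (hst j hjo hjs M hM).1)
    obtain ⟨l, hl, hlB⟩ := h₂.symm.isLongSimplex (fun j => (hcl j).2) (fun j => (hcl j).1) hsB hsA
      hs (fun j hjo hjs M hM => (hst j hjo hjs M hM.symm).2)
    have hmain := hlA.card_add_ge hlB hs hk hl (by rw [h₂.card_left, h₂.card_right]; exact hBA)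
    have hun : units o s A₂ ∪ units o s B₂ = (Finset.univ.erase o).erase s := by
      ext j
      simp only [Finset.mem_union, mem_units, Finset.mem_erase, Finset.mem_univ, and_true]
      have := h₂.single_mem j
      tauto
    have huncard : (units o s A₂ ∪ units o s B₂).card + 2 = d := by
      rw [hun, Finset.card_erase_of_mem (by simp [hs]), Finset.card_erase_of_mem (by simp),
        Finset.card_univ, hcard]
      omega
    have hI : (units o s A₂).card + 2 ≤ d := by
      have := Finset.card_le_card (Finset.subset_union_left :
        units o s A₂ ⊆ units o s A₂ ∪ units o s B₂)
      omega
    -- `s` itself belongs to `SB`, so the units of `B` off the axis number at most `|SB| - 1 ≤ c -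
    -- 2`, which gives `l ≥ r₂ - c + 2`.
    have hJ : (units o s B₂).card + 1 ≤ SB.card := by
      have hsSB : s ∈ SB := by
        by_contra hc
        simpa using h₂.supp_right s hc hs _ hsB
      rw [← Finset.card_erase_add_one hsSB]
      refine Nat.add_le_add_right (Finset.card_le_card fun j hj => ?_) 1
      obtain ⟨hjo, hjs, hjB⟩ := mem_units.1 hj
      refine Finset.mem_erase.2 ⟨hjs, ?_⟩
      by_contra hc
      simpa using h₂.supp_right j hc hjo _ hjB
    have hkb := hlA.card_base hs
    have hlb := hlB.card_base hs
    rw [h₂.base_left] at hkb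
    rw [h₂.base_right] at hlb
    have hk' : (r₁ : ℝ) - d + 2 ≤ k := by
      have : r₁ + 2 ≤ k + d := by omega
      have : (r₁ : ℝ) + 2 ≤ k + d := by exact_mod_cast this
      linarith
    have hl' : (r₂ : ℝ) - c + 2 ≤ l := by
      have : r₂ + 2 ≤ l + c := by omega
      have : (r₂ : ℝ) + 2 ≤ l + c := by exact_mod_cast this
      linarith
    have hr₁' : (d : ℝ) ≤ r₁ := by exact_mod_cast hr₁
    have hc' : (c : ℝ) ≤ r₂ := by exact_mod_cast hcr
    have e₁ : 1 / (k : ℝ) ≤ 1 / ((r₁ : ℝ) - d + 2) :=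
      one_div_le_one_div_of_le (by linarith) hk'
    have e₂ : 1 / (l : ℝ) ≤ 1 / ((r₂ : ℝ) - c + 2) :=
      one_div_le_one_div_of_le (by linarith) hl'
    have huncard' : ((units o s A₂ ∪ units o s B₂).card : ℝ) = d - 2 := by
      rw [← huncard]; push_cast; ring
    rw [huncard', h₂.card_left, h₂.card_right, h₂.base_left, h₂.base_right] at hmain
    have hN : ((A₂ + B₂).card : ℝ) ≤ N := by exact_mod_cast h₂.card_add
    have hmul := mul_le_mul_of_nonneg_right (add_le_add e₁ e₂) (Nat.cast_nonneg (α := ℝ) nB)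
    linarith
  · push Not at hex
    have hb := h₁.disjoint_bound (fun j => (hcl j).1) (fun j => (hcl j).2)
      (fun j hj hh => hex j hj hh.1 hh.2)
    refine disjoint_numeric hb ?_ ?_ hBA hd hr₁ (by omega) (by omega) hcr
    · rw [← h₁.base_left, ← h₁.card_left]; exact card_base_le _ _
    · rw [← h₁.base_right, ← h₁.card_right]; exact card_base_le _ _

end NatBound

/-! ### Reduction from a vector space to coordinates. -/

section Reduction

theorem card_image_le_card_image {α β γ : Type*} [DecidableEq β] [DecidableEq γ] {s : Finset α}
    {f : α → β} {g : α → γ} (h : ∀ x ∈ s, ∀ y ∈ s, g x = g y → f x = f y) :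
    (s.image f).card ≤ (s.image g).card := by
  rcases s.eq_empty_or_nonempty with rfl | ⟨a, -⟩
  · simp
  have : Nonempty α := ⟨a⟩
  have hex : ∀ b ∈ s.image f, ∃ x ∈ s, f x = b := fun b hb => Finset.mem_image.1 hb
  choose! t ht hft using hex
  refine Finset.card_le_card_of_injOn (fun b => g (t b))
    (fun b hb => Finset.mem_image_of_mem g (ht b hb)) fun b hb b' hb' hbb => ?_
  rw [← hft b hb, ← hft b' hb']
  exact h _ (ht b hb) _ (ht b' hb') hbb

theorem base_compress_self {ι R : Type*} [Fintype ι] [DecidableEq ι] [Semiring R] [LinearOrder R]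
    [IsStrictOrderedRing R] (o : ι) (X : Finset (ι → R)) :
    base o (compress o X) = X.image (fun x => update x o 0) := by
  ext x
  rw [mem_base, Finset.mem_image]
  constructor
  · rintro ⟨hx, hx0⟩
    obtain ⟨n, -, hn⟩ := mem_compress.1 hx
    obtain ⟨y, hy⟩ := Finset.card_pos.1 (Nat.zero_lt_of_lt hn)
    obtain ⟨hyX, hyx⟩ := mem_fiber.1 hy
    refine ⟨y, hyX, funext fun k => ?_⟩
    by_cases hk : k = o
    · subst hk; simp [hx0]
    · simp [hk, hyx k hk]
  · rintro ⟨y, hy, rfl⟩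
    exact ⟨mem_compress_of_eq_zero hy (fun k hk => by simp [hk]) (by simp), by simp⟩

variable {E F : Type*} [AddCommGroup E] [Module ℝ E] [AddCommGroup F] [Module ℝ F]
  [DecidableEq E] [DecidableEq F]

/-- Choose one preimage for each nonzero value of `P` on `B`. Together with `v`, which spans the
kernel, these span everything, and `v` takes the place of the value 0. -/
theorem finrank_span_insert_le {P : E →ₗ[ℝ] F} {v : E} (hP : P.ker = Submodule.span ℝ {v})
    {B : Finset E} (h0 : (0 : E) ∈ B) :
    Module.finrank ℝ (Submodule.span ℝ (insert v (B : Set E))) ≤ (B.image P).card := by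
  have hex : ∀ y ∈ B.image P, ∃ x ∈ B, P x = y := fun y hy => Finset.mem_image.1 hy
  choose! g hg hPg using hex
  have h0P : (0 : F) ∈ B.image P := Finset.mem_image.2 ⟨0, h0, map_zero P⟩
  set T : Finset E := insert v (((B.image P).erase 0).image g) with hT
  have hle : Submodule.span ℝ (insert v (B : Set E)) ≤ Submodule.span ℝ (T : Set E) := by
    have hvT : v ∈ Submodule.span ℝ (T : Set E) := Submodule.subset_span (by simp [hT])
    have hker : ∀ x, P x = 0 → x ∈ Submodule.span ℝ (T : Set E) := fun x hx => by
      have hx' : x ∈ Submodule.span ℝ {v} := hP ▸ (LinearMap.mem_ker.2 hx)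
      exact Submodule.span_mono (by simp [hT]) hx'
    rw [Submodule.span_le]
    rintro x (rfl | hx)
    · exact hvT
    have hx : x ∈ B := hx
    by_cases hx0 : P x = 0
    · exact hker x hx0
    have hxP := Finset.mem_image_of_mem P hx
    have hgT : g (P x) ∈ Submodule.span ℝ (T : Set E) := Submodule.subset_span <| by
      refine Finset.mem_coe.2 (Finset.mem_insert_of_mem (Finset.mem_image_of_mem g ?_))
      exact Finset.mem_erase.2 ⟨hx0, hxP⟩
    have := hker (x - g (P x)) (by rw [map_sub, hPg _ hxP, sub_self])
    have := add_mem this hgT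
    rwa [sub_add_cancel] at this
  have : FiniteDimensional ℝ (Submodule.span ℝ (T : Set E)) :=
    FiniteDimensional.span_finset ℝ T
  refine (Submodule.finrank_mono hle).trans ((finrank_span_finset_le_card T).trans ?_)
  refine (Finset.card_insert_le _ _).trans ?_
  have h1 : (((B.image P).erase 0).image g).card ≤ ((B.image P).erase 0).card :=
    Finset.card_image_le
  have h2 := Finset.card_erase_add_one h0P
  omega

/-- A basis adapted to a vector `v` and a pair of spanning sets: it contains `v`, its other members
lie in the two sets, and those outside `SB` do not contribute to the second set. -/
theorem exists_adapted_basis [FiniteDimensional ℝ E] {v : E} (hv : v ≠ 0) {A B : Set E}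
    (hspan : Submodule.span ℝ (insert v (B ∪ A)) = ⊤) :
    ∃ (ι : Type) (_ : Fintype ι) (_ : DecidableEq ι) (b : Module.Basis ι ℝ E) (o : ι)
      (SB : Finset ι), b o = v ∧ (∀ j, j ≠ o → b j ∈ A ∨ b j ∈ B) ∧
      SB.card + 1 = Module.finrank ℝ (Submodule.span ℝ (insert v B)) ∧
      ∀ j, j ∉ SB → j ≠ o → ∀ x ∈ B, b.repr x j = 0 := by
  classical
  have hv1 : LinearIndepOn ℝ id ({v} : Set E) := by
    simpa using LinearIndepOn.singleton (R := ℝ) (v := id) (i := v) hv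
  -- The extension first exhausts `B` and only then draws on `A`; so the members outside `b₁` do not
  -- occur in the coordinates of points of `B`.
  obtain ⟨b₁, hb₁, hvb₁, hB, hind₁⟩ := exists_linearIndepOn_id_extension hv1
    (show {v} ⊆ insert v B by simp)
  obtain ⟨b₂, hb₂, hb₁₂, hA, hind₂⟩ := exists_linearIndepOn_id_extension hind₁
    (show b₁ ⊆ insert v (B ∪ A) from hb₁.trans (Set.insert_subset_insert Set.subset_union_left))
  have htop : ⊤ ≤ Submodule.span ℝ b₂ := hspan ▸ Submodule.span_le.2 hA
  have hfin : Finite b₂ := hind₂.finite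
  obtain ⟨n, ⟨e⟩⟩ := Finite.exists_equiv_fin b₂
  let b' : Module.Basis b₂ ℝ E :=
    Module.Basis.mk (v := fun x : b₂ => (x : E)) hind₂ (by simpa using htop)
  let b : Module.Basis (Fin n) ℝ E := b'.reindex e
  have hb : ∀ j, b j = ((e.symm j : b₂) : E) := fun j => by
    rw [Module.Basis.reindex_apply]
    exact Module.Basis.mk_apply _ _ _
  have hvb₂ : v ∈ b₂ := hb₁₂ (hvb₁ rfl)
  let o : Fin n := e ⟨v, hvb₂⟩
  let S : Finset (Fin n) := Finset.univ.filter fun j => b j ∈ b₁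
  have hbo : b o = v := by simp [hb, o]
  have hoS : o ∈ S := by simp [S, hbo, hvb₁ rfl]
  have hbS : b '' (S : Set (Fin n)) = b₁ := by
    ext x
    constructor
    · rintro ⟨j, hj, rfl⟩
      simpa [S] using hj
    · intro hx
      refine ⟨e ⟨x, hb₁₂ hx⟩, ?_, by simp [hb]⟩
      simp [S, hb, hx]
  have hspan₁ : Submodule.span ℝ (insert v B) = Submodule.span ℝ b₁ :=
    le_antisymm (Submodule.span_le.2 hB) (Submodule.span_mono hb₁)
  refine ⟨Fin n, inferInstance, inferInstance, b, o, S.erase o, hbo, fun j hj => ?_, ?_, ?_⟩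
  · have h1 : b j ∈ b₂ := by rw [hb]; exact (e.symm j).2
    rcases hb₂ h1 with h2 | h2 | h2
    · exact absurd (b.injective (h2.trans hbo.symm)) hj
    · exact Or.inr h2
    · exact Or.inl h2
  · rw [Finset.card_erase_add_one hoS, hspan₁, ← hbS, ← Finset.coe_image,
      finrank_span_finset_eq_card, Finset.card_image_of_injective _ b.injective]
    rw [Finset.coe_image, hbS]
    exact hind₁
  · intro j hj hjo x hx
    have hxS : x ∈ Submodule.span ℝ (b '' (S : Set (Fin n))) := by
      rw [hbS]; exact hB (Set.mem_insert_of_mem _ hx)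
    have hjS : j ∉ S := fun h => hj (Finset.mem_erase.2 ⟨hjo, h⟩)
    have := (b.mem_span_image).1 hxS
    by_contra hne
    exact hjS (this (Finsupp.mem_support_iff.2 hne))

theorem card_add_ge_of_finrank [FiniteDimensional ℝ E] {P : E →ₗ[ℝ] F} {v : E} (hv : v ≠ 0)
    (hP : P.ker = Submodule.span ℝ {v}) {A B : Finset E} (hA0 : (0 : E) ∈ A) (hB0 : (0 : E) ∈ B)
    (hspan : Submodule.span ℝ ((B : Set E) ∪ A) = ⊤) {d c r₁ r₂ : ℕ}
    (hE : Module.finrank ℝ E = d) (hd : 2 ≤ d) (hA : (A.image P).card = r₁)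
    (hB : (B.image P).card = r₂) (hr₁ : d ≤ r₁) (hBA : B.card ≤ A.card)
    (hc : Module.finrank ℝ (Submodule.span ℝ (insert v (B : Set E))) ≤ c) (hcr : c ≤ r₂) :
    (A.card : ℝ) + (d + 1 - 1 / ((r₁ : ℝ) - d + 2) - 1 / ((r₂ : ℝ) - c + 2)) * B.card
      - (d - 1) * (r₁ + r₂) ≤ (A + B).card := by
  obtain ⟨ι, _, _, b, o, SB, hbo, hbj, hSB, hsupp⟩ := exists_adapted_basis hv
    (A := (A : Set E)) (B := (B : Set E))
    (top_le_iff.1 (hspan ▸ Submodule.span_mono (Set.subset_insert _ _)))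
  let φ : E ≃ₗ[ℝ] (ι → ℝ) := b.equivFun
  have hφ : ∀ j, φ (b j) = Pi.single j 1 := fun j => by
    ext k; simp [φ, Pi.single_apply, eq_comm]
  -- Two points have the same projection exactly when they differ by a multiple of `b o = v`, that
  -- is, when they lie on the same `o`-line.
  have hoff : ∀ x y, P x = P y ↔ update (φ x) o 0 = update (φ y) o 0 := by
    intro x y
    rw [← sub_eq_zero, ← map_sub, ← LinearMap.mem_ker, hP, Submodule.mem_span_singleton]
    constructor
    · rintro ⟨t, ht⟩
      have hxy : φ x = φ y + t • Pi.single o 1 := by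
        rw [← hφ, hbo, ← map_smul, ht, ← map_add]; simp
      ext k
      by_cases hk : k = o
      · subst hk; simp
      · simp [hk, hxy]
    · intro h
      refine ⟨φ x o - φ y o, φ.injective ?_⟩
      rw [map_smul, ← hbo, hφ, map_sub]
      ext k
      by_cases hk : k = o
      · subst hk; simp
      · have := congrFun h k
        simp only [update_of_ne hk] at this
        simp [hk, this]
  have hbase : ∀ X : Finset E,
      (base o (compress o (X.image φ))).card = (X.image P).card := fun X => by
    rw [base_compress_self, Finset.image_image]
    exact le_antisymm (card_image_le_card_image fun x _ y _ h => (hoff x y).1 h)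
      (card_image_le_card_image fun x _ y _ h => (hoff x y).2 h)
  have hmem0 : ∀ X : Finset E, (0 : E) ∈ X → (0 : ι → ℝ) ∈ X.image φ := fun X h =>
    Finset.mem_image.2 ⟨0, h, map_zero φ⟩
  have hcfg : IsConfig o Finset.univ SB A.card B.card r₁ r₂ (A + B).card
      (compress o (A.image φ)) (compress o (B.image φ)) :=
    { card_left := by rw [card_compress, Finset.card_image_of_injective _ φ.injective]
      card_right := by rw [card_compress, Finset.card_image_of_injective _ φ.injective]
      card_add := by
        refine (card_compress_add_le _ _ _).trans ?_
        rw [← Finset.image_add φ, Finset.card_image_of_injective _ φ.injective]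
      base_left := by rw [hbase, hA]
      base_right := by rw [hbase, hB]
      closed_left := closedAlong_compress _ _
      closed_right := closedAlong_compress _ _
      zero_left := mem_compress_of_eq_zero (hmem0 A hA0) (fun _ _ => rfl) rfl
      zero_right := mem_compress_of_eq_zero (hmem0 B hB0) (fun _ _ => rfl) rfl
      single_mem := fun j hj => (hbj j hj).imp
        (fun h => single_mem_compress (hmem0 A hA0) (hφ j ▸ Finset.mem_image_of_mem φ h))
        (fun h => single_mem_compress (hmem0 B hB0) (hφ j ▸ Finset.mem_image_of_mem φ h))
      supp_left := fun j hj => absurd (Finset.mem_univ j) hj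
      supp_right := fun j hj hjo => compress_apply_eq_zero fun x hx => by
        obtain ⟨y, hy, rfl⟩ := Finset.mem_image.1 hx
        exact hsupp j hj hjo y hy }
  obtain ⟨A', B', h'⟩ := hcfg.exists_nat (compress_apply_eq_cast (Or.inl rfl))
    (compress_apply_eq_cast (Or.inl rfl))
  exact h'.bound (by rw [← hE, Module.finrank_eq_card_basis b]) hd hr₁ hBA (hSB ▸ hc) hcr

/-- `card_add_ge_of_finrank` requires `c` to be at least the dimension of the span of `v` and `B`.
This fails only if `r₂ < d` and `v` is outside the span of `B`, a case in which `B` is small. -/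
theorem card_add_ge_of_zero_mem [FiniteDimensional ℝ E] {P : E →ₗ[ℝ] F} {v : E} (hv : v ≠ 0)
    (hP : P.ker = Submodule.span ℝ {v}) {A B : Finset E} (hA0 : (0 : E) ∈ A) (hB0 : (0 : E) ∈ B)
    (hspan : Submodule.span ℝ ((B : Set E) ∪ A) = ⊤) {d c r₁ r₂ : ℕ}
    (hE : Module.finrank ℝ E = d) (hd : 2 ≤ d) (hA : (A.image P).card = r₁)
    (hB : (B.image P).card = r₂) (hr₁ : d ≤ r₁) (hBA : B.card ≤ A.card)
    (hc : d ≤ r₂ → c = d)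
    (hc' : r₂ < d → c = Module.finrank ℝ (Submodule.span ℝ (B : Set E))) :
    (A.card : ℝ) + (d + 1 - 1 / ((r₁ : ℝ) - d + 2) - 1 / ((r₂ : ℝ) - c + 2)) * B.card
      - (d - 1) * (r₁ + r₂) ≤ (A + B).card := by
  have hle : Module.finrank ℝ (Submodule.span ℝ (insert v (B : Set E))) ≤ r₂ :=
    hB ▸ finrank_span_insert_le hP hB0
  rcases le_or_gt d r₂ with hr₂ | hr₂
  · obtain rfl := hc hr₂
    exact card_add_ge_of_finrank hv hP hA0 hB0 hspan hE hd hA hB hr₁ hBA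
      ((Submodule.finrank_le _).trans_eq hE) hr₂
  have hcB := hc' hr₂
  by_cases hvB : v ∈ Submodule.span ℝ (B : Set E)
  · rw [Submodule.span_insert_eq_span hvB, ← hcB] at hle
    exact card_add_ge_of_finrank hv hP hA0 hB0 hspan hE hd hA hB hr₁ hBA
      (by rw [Submodule.span_insert_eq_span hvB, hcB]) hle
  -- A nonzero difference of points of `B` along `v` would put `v` in the span of `B`. So `|B| = r₂
  -- ≤ d - 1`, and the subtracted `(d - 1)(r₁ + r₂)` outweighs `(d + 1) r₂`.
  have hinj : Set.InjOn P B := by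
    intro x hx y hy hxy
    have hmem : x - y ∈ Submodule.span ℝ {v} := by
      rw [← hP, LinearMap.mem_ker, map_sub, hxy, sub_self]
    obtain ⟨t, ht⟩ := Submodule.mem_span_singleton.1 hmem
    rcases eq_or_ne t 0 with rfl | ht0
    · rw [zero_smul] at ht
      exact (sub_eq_zero.1 ht.symm)
    · refine absurd ?_ hvB
      rw [← Submodule.smul_mem_iff _ ht0, ht]
      exact sub_mem (Submodule.subset_span hx) (Submodule.subset_span hy)
  have hBr : B.card = r₂ := by rw [← hB, Finset.card_image_of_injOn hinj]
  have hcr : c ≤ r₂ := hcB ▸ (Submodule.finrank_mono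
    (Submodule.span_mono (Set.subset_insert _ _))).trans hle
  have hAN : (A.card : ℝ) ≤ (A + B).card := by
    exact_mod_cast Finset.card_le_card_add_right ⟨0, hB0⟩
  have h1 : (0 : ℝ) ≤ 1 / ((r₁ : ℝ) - d + 2) := by
    have : (d : ℝ) ≤ r₁ := by exact_mod_cast hr₁
    apply div_nonneg <;> linarith
  have h2 : (0 : ℝ) ≤ 1 / ((r₂ : ℝ) - c + 2) := by
    have : (c : ℝ) ≤ r₂ := by exact_mod_cast hcr
    apply div_nonneg <;> linarith
  have hd' : (2 : ℝ) ≤ d := by exact_mod_cast hd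
  have hr₁' : (d : ℝ) ≤ r₁ := by exact_mod_cast hr₁
  have hr₂' : (r₂ : ℝ) + 1 ≤ d := by exact_mod_cast hr₂
  have hr0 : (0 : ℝ) ≤ r₂ := by positivity
  rw [hBr]
  have h3 := mul_nonneg (add_nonneg h1 h2) hr0
  have h4 : 2 * (r₂ : ℝ) ≤ (d - 1) * r₁ := by nlinarith
  nlinarith

end Reduction

/-! ### Translation to the origin and conclusion. -/

theorem finrank_direction_affineSpan {E : Type*} [AddCommGroup E] [Module ℝ E] {S : Set E} {a : E}
    (ha : a ∈ S) : Module.finrank ℝ (affineSpan ℝ S).direction =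
      Module.finrank ℝ (Submodule.span ℝ ((fun x => x - a) '' S)) := by
  rw [direction_affineSpan, vectorSpan_eq_span_vsub_set_right ℝ ha]
  rfl

theorem ker_orthogonalProjectionOnto_orthHyperplane {d : ℕ} (v : EuclideanSpace ℝ (Fin d)) :
    ((orthHyperplane v).orthogonalProjectionOnto :
      EuclideanSpace ℝ (Fin d) →ₗ[ℝ] orthHyperplane v).ker =
      Submodule.span ℝ {v} := by
  have := Submodule.ker_orthogonalProjectionOnto (K := orthHyperplane v)
  rw [orthHyperplane, Submodule.orthogonal_orthogonal] at this
  exact this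

theorem mainTheorem3 (r₁ r₂ d c : ℕ) (hd : 2 ≤ d) (hr₁ : d ≤ r₁)
    (A B : Set (EuclideanSpace ℝ (Fin d)))
    (hAfin : A.Finite) (hBfin : B.Finite) (hA : A.Nonempty) (hB : B.Nonempty)
    (hcard : B.ncard ≤ A.ncard) (hdim : affDim (A + B) = d)
    (v : EuclideanSpace ℝ (Fin d)) (hv : v ≠ 0)
    (hπA : (projAlong v '' A).ncard = r₁) (hπB : (projAlong v '' B).ncard = r₂)
    (hc : d ≤ r₂ → c = d) (hc' : r₂ < d → c = affDim B) :
    ((A + B).ncard : ℝ) ≥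
      (A.ncard : ℝ)
        + ((d : ℝ) + 1 - 1 / ((r₁ : ℝ) - (d : ℝ) + 2) - 1 / ((r₂ : ℝ) - (c : ℝ) + 2))
            * (B.ncard : ℝ)
        - ((d : ℝ) - 1) * ((r₁ : ℝ) + (r₂ : ℝ)) := by
  classical
  lift A to Finset (EuclideanSpace ℝ (Fin d)) using hAfin
  lift B to Finset (EuclideanSpace ℝ (Fin d)) using hBfin
  obtain ⟨a, ha⟩ := hA
  obtain ⟨b, hb⟩ := hB
  set P : EuclideanSpace ℝ (Fin d) →ₗ[ℝ] orthHyperplane v :=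
    ((orthHyperplane v).orthogonalProjectionOnto :
      EuclideanSpace ℝ (Fin d) →ₗ[ℝ] orthHyperplane v)
  have hproj : ∀ (X : Finset (EuclideanSpace ℝ (Fin d))) (x : EuclideanSpace ℝ (Fin d)),
      ((X.image (fun y => y - x)).image P).card = (projAlong v '' X).ncard := by
    intro X x
    have h1 : projAlong v '' (X : Set (EuclideanSpace ℝ (Fin d))) = (X.image P : Finset _) := by
      rw [Finset.coe_image]; rfl
    have h2 : (X.image (fun y => y - x)).image P = (X.image P).image (fun y => y - P x) := by
      rw [Finset.image_image, Finset.image_image]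
      exact Finset.image_congr fun y _ => map_sub P y x
    rw [h1, Set.ncard_coe_finset, h2, Finset.card_image_of_injective _ (sub_left_injective)]
  have hcardsub : ∀ (X : Finset (EuclideanSpace ℝ (Fin d))) (x : EuclideanSpace ℝ (Fin d)),
      (X.image (fun y => y - x)).card = X.card := fun X x =>
    Finset.card_image_of_injective _ sub_left_injective
  have hadd : A.image (fun y => y - a) + B.image (fun y => y - b) =
      (A + B).image (fun y => y - (a + b)) := by
    ext z
    simp only [Finset.mem_add, Finset.mem_image]
    constructor
    · rintro ⟨_, ⟨x, hx, rfl⟩, _, ⟨y, hy, rfl⟩, rfl⟩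
      exact ⟨x + y, ⟨x, hx, y, hy, rfl⟩, by abel⟩
    · rintro ⟨_, ⟨x, hx, y, hy, rfl⟩, rfl⟩
      exact ⟨_, ⟨x, hx, rfl⟩, _, ⟨y, hy, rfl⟩, by abel⟩
  have hspan : Submodule.span ℝ ((B.image (fun y => y - b) : Set (EuclideanSpace ℝ (Fin d))) ∪
      A.image (fun y => y - a)) = ⊤ := by
    -- The differences `x + y - (a + b)` span the space because `A + B` has full dimension, and each
    -- is a sum of a point of `A - a` and one of `B - b`.
    rw [affDim, finrank_direction_affineSpan (Set.add_mem_add ha hb)] at hdim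
    have h1 : Submodule.span ℝ ((fun x => x - (a + b)) ''
        ((A : Set (EuclideanSpace ℝ (Fin d))) + B)) = ⊤ :=
      Submodule.eq_top_of_finrank_eq (by rw [hdim, finrank_euclideanSpace_fin])
    rw [eq_top_iff, ← h1, Submodule.span_le]
    rintro _ ⟨_, ⟨x, hx, y, hy, rfl⟩, rfl⟩
    have : x + y - (a + b) = (x - a) + (y - b) := by abel
    simp only [this]
    exact add_mem
      (Submodule.subset_span (Or.inr (Finset.mem_coe.2 (Finset.mem_image_of_mem _ hx))))
      (Submodule.subset_span (Or.inl (Finset.mem_coe.2 (Finset.mem_image_of_mem _ hy))))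
  have key := card_add_ge_of_zero_mem hv (ker_orthogonalProjectionOnto_orthHyperplane v)
    (A := A.image (fun y => y - a)) (B := B.image (fun y => y - b))
    (Finset.mem_image.2 ⟨a, ha, sub_self a⟩) (Finset.mem_image.2 ⟨b, hb, sub_self b⟩) hspan
    finrank_euclideanSpace_fin hd ((hproj A a).trans hπA) ((hproj B b).trans hπB) hr₁
    (by simpa [hcardsub] using hcard) hc
    (fun h => by rw [hc' h, affDim, finrank_direction_affineSpan hb, Finset.coe_image])
  rw [hcardsub, hcardsub, hadd, hcardsub] at key
  rw [← Finset.coe_add, Set.ncard_coe_finset, Set.ncard_coe_finset, Set.ncard_coe_finset]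
  exact key
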